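/- Let $\overline{\mathbb Z}_{\max}=\mathbb Z\cup\{\pm\infty\}$ with $\oplus=\max$ and $\otimes=+$ (where $(-\infty)\otimes(+\infty)=-\infty$), and let $\mathcal S=\overline{\mathbb Z}_{\max}[[\gamma]]$ be the complete idempotent semiring of series $s=\bigoplus_{k\in\mathbb Z}s(k)\gamma^k$ with nondecreasing coefficients (equivalently, with the simplification rule $t\gamma^m\oplus t\gamma^n=t\gamma^{\min(m,n)}$), with null element $\varepsilon$ and unit $e=0\gamma^0$. Write $a^*=\bigoplus_{i\ge 0}a^i$, and write $N⌿M$ for the greatest $X$ with $XM\preceq N$. A polynomial is a finite, possibly empty, sum of monomials $t\gamma^n$ with $t,n\in\mathbb Z$. A series $s$ is periodic if $s=p\oplus q(\tau\gamma^{\nu})^*$ with polynomials $p,q$ and integers $\tau,\nu\ge 0$, not both zero. If such a representation has $q\neq\varepsilon$, the asymptotic slope of $s$ is $\sigma_\infty(s)=\nu/\tau\in[0,\infty]$ (equal to $\infty$ when $\tau=0$). Consider a timed event graph $x=Ax\oplus Bu\oplus Rw$, $y=Cx$ with internal transitions $x_1,\dots,x_n$, where $A_{ij}$ is the sum of the monomials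 $\tau\gamma^{\nu}$ over the finitely many places from $x_j$ to $x_i$ ($\tau\in\mathbb N$ the holding time, $\nu\in\mathbb N$ the number of tokens). Each column of $B$ and of $R$ and each row of $C$ has one entry $e$, the others being $\varepsilon$, and each row of $B$ and of $R$ and each column of $C$ has at most one entry $e$. Let $k$ be the number of strongly connected components of the graph of $A$ (arcs $x_j\to x_i$ whenever $A_{ij}\ne\varepsilon$), and suppose that $C$ has $k$ rows and that each strongly connected component is linked to one and only one output. Put $$L_x=\big((A^*B)⌿(CA^*B)\big)\wedge\big((A^*R)⌿(CA^*R)\big),$$ $$x=A^*(Bu\oplus Rw),\qquad \hat x=(A\oplus L_xC)^*(Bu\oplus L_xCx).$$ Then for all vectors $u,w$ of periodic series and every $i\in\{1,\dots,n\}$: either $x_i=\hat x_i=\varepsilon$, or $x_i$ and $\hat x_i$ are both periodic, have an asymptotic slope, and $\sigma_\infty(x_i)=\sigma_\infty(\hat x_i)$. Moreover the estimation error is bounded: $\hat x_i(q)\le x_i(q)$ for all $q\in\mathbb Z$, and there is $M\in\mathbb N$ such that $x_i(q)\le\hat x_i(q)+M$ for every $q$ at which both dates $x_i(q)$ and $\hat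 x_i(q)$ are finite, and also for every sufficiently large $q$. -/

import Mathlib

open scoped ENNReal

noncomputable section

namespace MaxPlus

/-- The carrier `ℤ ∪ {-∞, +∞}` of the complete max-plus semiring: the semiring sum is `⊔` (max), the
semiring product is `+`, with the convention `(-∞) + (+∞) = -∞`. -/
abbrev ZMax : Type := WithBot (WithTop ℤ)

theorem ZMax.add_iSup {ι : Sort*} (a : ZMax) (f : ι → ZMax) :
    a + ⨆ i, f i = ⨆ i, a + f i := by
  apply le_antisymm
  · induction a using WithBot.recBotCoe with
    | bot => simp
    | coe a =>
      induction a using WithTop.recTopCoe with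
      | top =>
        by_cases h : ∀ i, f i = ⊥
        · simp [h]
        · push Not at h
          obtain ⟨i, hi⟩ := h
          have h1 : (⊤ : ZMax) ≤ ((⊤ : WithTop ℤ) : ZMax) + f i := by
            obtain ⟨c, hc⟩ := WithBot.ne_bot_iff_exists.mp hi
            rw [← hc, ← WithBot.coe_add, top_add]
            exact le_rfl
          exact le_top.trans (h1.trans (le_iSup (fun i => ((⊤ : WithTop ℤ) : ZMax) + f i) i))
      | coe a =>
        have key : ∀ x : ZMax, (((-a : ℤ) : WithTop ℤ) : ZMax) + (((a : WithTop ℤ) : ZMax) + x) = x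
            ∧ (((a : ℤ) : WithTop ℤ) : ZMax) + ((((-a : ℤ) : WithTop ℤ) : ZMax) + x) = x := by
          intro x
          constructor <;>
          · rw [← add_assoc, ← WithBot.coe_add, ← WithTop.coe_add]
            simp
        have h : (⨆ i, f i) ≤ (((-a : ℤ) : WithTop ℤ) : ZMax)
            + ⨆ i, (((a : WithTop ℤ) : ZMax) + f i) := by
          refine iSup_le fun i => ?_
          calc f i = (((-a : ℤ) : WithTop ℤ) : ZMax) + (((a : WithTop ℤ) : ZMax) + f i) :=
                (key _).1.symm
            _ ≤ _ := by
                gcongr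
                exact le_iSup (fun i => (((a : WithTop ℤ) : ZMax) + f i)) i
        calc _ ≤ (((a : WithTop ℤ) : ZMax)) + ((((-a : ℤ) : WithTop ℤ) : ZMax)
            + ⨆ i, (((a : WithTop ℤ) : ZMax) + f i)) := by gcongr
          _ = _ := (key _).2
  · exact iSup_le fun i => by gcongr; exact le_iSup f i

theorem ZMax.iSup_add {ι : Sort*} (a : ZMax) (f : ι → ZMax) :
    (⨆ i, f i) + a = ⨆ i, f i + a := by
  rw [add_comm, ZMax.add_iSup]
  simp_rw [add_comm]

/-- Formal series `⨁ₖ s(k) γᵏ` (`k ∈ ℤ`) over the max-plus semiring that represent the trajectories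
(sequences of firing dates) of event graph transitions: the `k`-th firing date is nondecreasing
in `k`, which is expressed by the simplification rule `t γᵐ ⊕ t γⁿ = t γ^(min m n)`. -/
def Series : Type := ℤ →o ZMax

namespace Series

instance : CompleteLattice Series := inferInstanceAs (CompleteLattice (ℤ →o ZMax))

instance : FunLike Series ℤ ZMax := inferInstanceAs (FunLike (ℤ →o ZMax) ℤ ZMax)

@[ext] theorem ext {s t : Series} (h : ∀ k, s k = t k) : s = t := DFunLike.ext _ _ h

theorem mono (s : Series) {k l : ℤ} (h : k ≤ l) : s k ≤ s l := OrderHom.mono (α := ℤ) s h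

theorem le_def {s t : Series} : s ≤ t ↔ ∀ k, s k ≤ t k := Iff.rfl

@[simp] theorem sup_apply (s t : Series) (k : ℤ) : (s ⊔ t) k = s k ⊔ t k := rfl

@[simp] theorem bot_apply (k : ℤ) : (⊥ : Series) k = ⊥ := rfl

@[simp] theorem iSup_apply {ι : Sort*} (f : ι → Series) (k : ℤ) : (⨆ i, f i) k = ⨆ i, f i k :=
  OrderHom.iSup_apply (α := ℤ) (β := ZMax) f k

/-- The monomial `t γⁿ`: the date is `-∞` before the `n`-th event and `t` from then on. -/
def monomial (t n : ℤ) : Series where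
  toFun k := if n ≤ k then ((t : WithTop ℤ) : ZMax) else ⊥
  monotone' k l h := by
    dsimp only
    split_ifs with h1 h2
    · exact le_rfl
    · exact absurd (h1.trans h) h2
    · exact bot_le
    · exact le_rfl

/-- The product of series (Cauchy product over the max-plus semiring). -/
instance : Mul Series where
  mul s t :=
    { toFun := fun k => ⨆ j : ℤ, s j + t (k - j)
      monotone' := fun k l h => iSup_mono fun j => by
        gcongr
        exact t.mono (by lia) }

/-- The sum of series is the pointwise maximum. -/
instance : Add Series := ⟨fun s t => s ⊔ t⟩

/-- The null series `ε`. -/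
instance : Zero Series := ⟨⊥⟩

/-- The unit series `e = 0 γ⁰`. -/
instance : One Series := ⟨monomial 0 0⟩

theorem mul_apply (s t : Series) (k : ℤ) : (s * t) k = ⨆ j : ℤ, s j + t (k - j) := rfl

theorem add_def (s t : Series) : s + t = s ⊔ t := rfl

theorem zero_def : (0 : Series) = ⊥ := rfl

theorem one_apply (k : ℤ) : (1 : Series) k = if 0 ≤ k then (0 : ZMax) else ⊥ := rfl

protected theorem mul_comm' (s t : Series) : s * t = t * s := by
  ext k
  rw [mul_apply, mul_apply, ← (Equiv.subLeft k).iSup_comp]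
  refine iSup_congr fun j => ?_
  rw [Equiv.subLeft_apply, sub_sub_cancel, add_comm]

protected theorem mul_iSup' {ι : Sort*} (s : Series) (f : ι → Series) :
    s * ⨆ i, f i = ⨆ i, s * f i := by
  ext k
  simp only [mul_apply, iSup_apply, ZMax.add_iSup]
  exact iSup_comm

protected theorem one_mul' (s : Series) : 1 * s = s := by
  ext k
  rw [mul_apply]
  apply le_antisymm
  · refine iSup_le fun j => ?_
    rw [one_apply]
    split_ifs with h
    · rw [zero_add]
      exact s.mono (by lia)
    · simp
  · refine le_trans ?_ (le_iSup (fun j => (1 : Series) j + s (k - j)) 0)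
    simp [one_apply]

protected theorem mul_assoc' (s t r : Series) : s * t * r = s * (t * r) := by
  ext k
  simp only [mul_apply, ZMax.iSup_add, ZMax.add_iSup]
  rw [iSup_comm]
  refine iSup_congr fun i => ?_
  rw [← (Equiv.addRight i).iSup_comp]
  refine iSup_congr fun j => ?_
  simp only [Equiv.coe_addRight]
  rw [add_assoc, add_sub_cancel_right, show k - (j + i) = k - i - j by ring]

protected theorem mul_sup' (s t r : Series) : s * (t ⊔ r) = s * t ⊔ s * r := by
  rw [sup_eq_iSup, Series.mul_iSup', sup_eq_iSup]
  exact iSup_congr fun b => by cases b <;> rfl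

protected theorem mul_bot' (s : Series) : s * ⊥ = ⊥ := by
  ext k
  simp [mul_apply]

instance : CommSemiring Series where
  add_assoc a b c := sup_assoc a b c
  zero_add a := bot_sup_eq a
  add_zero a := sup_bot_eq a
  add_comm a b := sup_comm a b
  nsmul := nsmulRec
  left_distrib a b c := Series.mul_sup' a b c
  right_distrib a b c := by
    rw [Series.mul_comm', Series.mul_comm' a, Series.mul_comm' b]
    exact Series.mul_sup' c a b
  zero_mul a := by rw [Series.mul_comm']; exact Series.mul_bot' a
  mul_zero a := Series.mul_bot' a
  mul_assoc := Series.mul_assoc'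
  one_mul := Series.one_mul'
  mul_one a := by rw [Series.mul_comm']; exact Series.one_mul' a
  mul_comm := Series.mul_comm'

/-- The product distributes over arbitrary sums, so the semiring of series is complete. -/
instance : IsQuantale Series where
  mul_sSup_distrib x s := by simp only [sSup_eq_iSup, Series.mul_iSup']
  sSup_mul_distrib s x := by
    rw [Series.mul_comm']
    simp only [sSup_eq_iSup, Series.mul_iSup']
    exact iSup_congr fun a => iSup_congr fun _ => Series.mul_comm' x a

/-- The polynomial `⨁ t γⁿ` over the finitely many pairs `(t, n)` in `F`. -/
def polynomial (F : Finset (ℤ × ℤ)) : Series := ∑ m ∈ F, monomial m.1 m.2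

/-- The Kleene star `s* = ⨁ᵢ sⁱ` of a series. -/
def star (s : Series) : Series := ⨆ i : ℕ, s ^ i

/-- `s = p ⊕ q r*` for polynomials `p`, `q` and a monomial `r = τ γ^ν` with `τ, ν ≥ 0` not both zero.
(Here `p` and `q` may be `ε`, so that `ε` and all polynomials are periodic.) -/
def IsPeriodic (s : Series) : Prop :=
  ∃ (F G : Finset (ℤ × ℤ)) (τ ν : ℕ), (τ ≠ 0 ∨ ν ≠ 0) ∧
    s = polynomial F + polynomial G * star (monomial τ ν)

/-- The relation `σ∞(s) = σ`: the series `s` is periodic, `s = p ⊕ q r*` with `q ≠ ε` and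
`r = τ γ^ν`, and `σ = ν / τ`, which is `+∞` when `τ = 0`. The series `ε` has no slope. -/
def HasSlope (s : Series) (σ : ℝ≥0∞) : Prop :=
  ∃ (F G : Finset (ℤ × ℤ)) (τ ν : ℕ), (τ ≠ 0 ∨ ν ≠ 0) ∧ G.Nonempty ∧
    s = polynomial F + polynomial G * star (monomial τ ν) ∧ σ = (ν : ℝ≥0∞) / (τ : ℝ≥0∞)

end Series

open Quantale

/-- The Kleene star `A* = ⨁ᵢ Aⁱ` of a square matrix. -/
def matStar {n : ℕ} (A : Matrix (Fin n) (Fin n) Series) : Matrix (Fin n) (Fin n) Series :=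
  Matrix.of fun i j => ⨆ q : ℕ, (A ^ q) i j

/-- The right residual `N ⌿ M` of matrices, the greatest `X` with `X M ≤ N`: its entry `(i, j)` is
the meet over `c` of the scalar residuals of `N i c` by `M j c`. -/
def matResidual {n m p : ℕ} (N : Matrix (Fin n) (Fin p) Series) (M : Matrix (Fin m) (Fin p) Series) :
    Matrix (Fin n) (Fin m) Series :=
  Matrix.of fun i j => ⨅ c, (M j c ⇨ₗ N i c)

/-- `A` is the matrix of a timed event graph with internal transitions `x_1, …, x_n`: `A i j` is the
sum of the monomials `τ γ^ν` over the finitely many places from `x_j` to `x_i`, where `τ` is the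
holding time of the place and `ν` its number of initial tokens. -/
def IsEventGraphMatrix {n : ℕ} (A : Matrix (Fin n) (Fin n) Series) : Prop :=
  ∃ places : Fin n → Fin n → Finset (ℕ × ℕ),
    ∀ i j, A i j = ∑ b ∈ places i j, Series.monomial (b.1 : ℤ) (b.2 : ℤ)

/-- `B` (or `R`) links every input to the internal transition `f c`: column `c` has the entry `e` in
row `f c` and `ε` elsewhere, and no row has more than one entry `e`. -/
def IsInputMatrix {n p : ℕ} (B : Matrix (Fin n) (Fin p) Series) : Prop :=
  ∃ f : Fin p → Fin n, Function.Injective f ∧ ∀ i c, B i c = if i = f c then 1 else 0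

/-- `C` links output `r` to the internal transition `o r`: row `r` has the entry `e` in column `o r`
and `ε` elsewhere, and (for injective `o`) no column has more than one entry `e`. -/
def IsOutputMatrix {n m : ℕ} (C : Matrix (Fin m) (Fin n) Series) (o : Fin m → Fin n) : Prop :=
  Function.Injective o ∧ ∀ r j, C r j = if j = o r then 1 else 0

/-- There is a (possibly empty) path from transition `j` to transition `i` in the graph of `A`, whose
arcs are the pairs `j → i` with `A i j ≠ ε`. -/
def Reaches {n : ℕ} (A : Matrix (Fin n) (Fin n) Series) (j i : Fin n) : Prop :=
  Relation.ReflTransGen (fun a b => A b a ≠ 0) j i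

/-- Two transitions are strongly connected if there are paths in both directions. -/
def sccSetoid {n : ℕ} (A : Matrix (Fin n) (Fin n) Series) : Setoid (Fin n) where
  r i j := Reaches A i j ∧ Reaches A j i
  iseqv :=
    { refl := fun _ => ⟨Relation.ReflTransGen.refl, Relation.ReflTransGen.refl⟩
      symm := fun h => ⟨h.2, h.1⟩
      trans := fun h h' => ⟨h.1.trans h'.1, h'.2.trans h.2⟩ }

/-- The strongly connected components of the graph of `A`. -/
def SCC {n : ℕ} (A : Matrix (Fin n) (Fin n) Series) : Type := Quotient (sccSetoid A)

/-- The component of a transition. -/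
def SCC.mk {n : ℕ} (A : Matrix (Fin n) (Fin n) Series) (i : Fin n) : SCC A :=
  Quotient.mk (sccSetoid A) i

/-- The state `x = A*(B u ⊕ R w)`, the least solution of `x = A x ⊕ B u ⊕ R w`. -/
def state {n p l : ℕ} (A : Matrix (Fin n) (Fin n) Series) (B : Matrix (Fin n) (Fin p) Series)
    (R : Matrix (Fin n) (Fin l) Series) (u : Fin p → Series) (w : Fin l → Series) :
    Fin n → Series :=
  (matStar A).mulVec (B.mulVec u + R.mulVec w)

/-- The optimal observer matrix `Lₓ = (A*B) ⌿ (CA*B) ∧ (A*R) ⌿ (CA*R)`. -/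
def observerMatrix {n p l m : ℕ} (A : Matrix (Fin n) (Fin n) Series)
    (B : Matrix (Fin n) (Fin p) Series) (C : Matrix (Fin m) (Fin n) Series)
    (R : Matrix (Fin n) (Fin l) Series) : Matrix (Fin n) (Fin m) Series :=
  Matrix.of fun i j =>
    matResidual (matStar A * B) (C * matStar A * B) i j ⊓
      matResidual (matStar A * R) (C * matStar A * R) i j

/-- The estimate `x̂ = (A ⊕ L C)*(B u ⊕ L y)` with `y = C x`, the least solution of
`x̂ = A x̂ ⊕ B u ⊕ L (C x̂ ⊕ y)`, for the optimal observer matrix `L = Lₓ`. -/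
def estimate {n p l m : ℕ} (A : Matrix (Fin n) (Fin n) Series)
    (B : Matrix (Fin n) (Fin p) Series) (C : Matrix (Fin m) (Fin n) Series)
    (R : Matrix (Fin n) (Fin l) Series) (u : Fin p → Series) (w : Fin l → Series) :
    Fin n → Series :=
  (matStar (A + observerMatrix A B C R * C)).mulVec
    (B.mulVec u + (observerMatrix A B C R).mulVec (C.mulVec (state A B R u w)))

end MaxPlus

end

/-! Write L for the observer matrix. The residual inequalities L(CA*B) ≤ A*B and L(CA*R) ≤ A*R give
LCx ≤ x, so x solves the fixed point inequality of the observer and x̂ ≤ x. Hence the feedback of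
the observer's own output is dominated by LCx, and x̂ = A*(Bu ⊕ LCx) (`estimate_eq`).

Conversely, A*A* ≤ A* shows that column `o r` of A* lies below column r of L. If `o r` and i share a
component, paths in both directions give γ^N₁ ≤ A*(i, o r) and γ^N₂ ≤ A*(o r, i), since holding
times are nonnegative. With N = N₁ + N₂ this yields γ^N xᵢ ≤ x̂ᵢ ≤ xᵢ
(`exists_monomial_mul_state_le_estimate`): the two series differ by a bounded shift of the event
numbering.

The shift becomes a bound on dates once both series are periodic, i.e. null for small k with s(k +
ν) = s(k) + τ for large k. Entries of A* are periodic by Gaussian elimination in a star-closed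
semiring of causal rational series (`exists_least_solution`, `star_mem_rational`). Sums, meets,
products and residuals by nonzero series preserve periodicity, which settles x and x̂. A bounded
shift does not change the growth rate, so the slopes agree (`exists_common_slope`), and N periods
cover the shift at cost Nτ (`exists_error_bound`). -/

namespace MaxPlus

/-! ### Order and Kleene stars of series -/

namespace Series

instance : IsOrderedAddMonoid Series where
  add_le_add_left _ _ h c := sup_le_sup_right h c

theorem zero_le' (a : Series) : 0 ≤ a := bot_le

theorem le_zero_iff {a : Series} : a ≤ 0 ↔ a = 0 := le_bot_iff

theorem add_le_iff {a b c : Series} : a + b ≤ c ↔ a ≤ c ∧ b ≤ c := sup_le_iff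

theorem le_add_left' (a b : Series) : a ≤ a + b := le_sup_left

theorem le_add_right' (a b : Series) : b ≤ a + b := le_sup_right

theorem sum_le {ι : Type*} {s : Finset ι} {f : ι → Series} {x : Series}
    (h : ∀ i ∈ s, f i ≤ x) : ∑ i ∈ s, f i ≤ x := by
  classical
  induction s using Finset.induction_on with
  | empty => simpa using zero_le' x
  | insert a s ha ih =>
    rw [Finset.sum_insert ha]
    exact add_le_iff.2 ⟨h a (by simp), ih fun i hi => h i (by simp [hi])⟩

theorem le_sum {ι : Type*} {s : Finset ι} (f : ι → Series) {i : ι} (hi : i ∈ s) :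
    f i ≤ ∑ j ∈ s, f j :=
  Finset.single_le_sum (fun j _ => zero_le' (f j)) hi

theorem mul_le_mul_of_le {a b c d : Series} (h : a ≤ c) (h' : b ≤ d) : a * b ≤ c * d :=
  mul_le_mul' h h'

theorem one_le_star (a : Series) : 1 ≤ star a := by
  have := le_iSup (fun i : ℕ => a ^ i) 0
  simpa [star] using this

theorem pow_le_star (a : Series) (i : ℕ) : a ^ i ≤ star a := le_iSup (fun i : ℕ => a ^ i) i

theorem le_star (a : Series) : a ≤ star a := by simpa using pow_le_star a 1

theorem mul_star_le (a : Series) : a * star a ≤ star a := by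
  rw [star, Quantale.mul_iSup_distrib]
  exact iSup_le fun i => by rw [← pow_succ']; exact pow_le_star a (i + 1)

theorem star_mul_le {a b x : Series} (hb : b ≤ x) (h : a * x ≤ x) : star a * b ≤ x := by
  rw [star, Quantale.iSup_mul_distrib]
  refine iSup_le fun i => ?_
  induction i with
  | zero => simpa using hb
  | succ i ih =>
    rw [pow_succ', mul_assoc]
    exact (mul_le_mul_of_le le_rfl ih).trans h

theorem star_le {a x : Series} (hx : 1 ≤ x) (h : a * x ≤ x) : star a ≤ x := by
  simpa using star_mul_le hx h

theorem star_mul_star (a : Series) : star a * star a = star a := by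
  apply le_antisymm
  · exact star_mul_le le_rfl (mul_star_le a)
  · exact le_mul_of_one_le_left' (one_le_star a)

theorem star_le_star_iff {a b : Series} : star a ≤ star b ↔ a ≤ star b := by
  refine ⟨(le_star a).trans, fun h => star_le (one_le_star b) ?_⟩
  exact (mul_le_mul_of_le h le_rfl).trans (star_mul_star b).le

/-- Commutativity lets every word in a and b be sorted into a power of a times a power of b. -/
theorem star_add (a b : Series) : star (a + b) = star a * star b := by
  apply le_antisymm
  · refine star_le ?_ ?_
    · exact one_le_mul (one_le_star a) (one_le_star b)
    · rw [add_mul, add_le_iff, ← mul_assoc, mul_left_comm]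
      exact ⟨mul_le_mul_of_le (mul_star_le a) le_rfl, mul_le_mul_of_le le_rfl (mul_star_le b)⟩
  · rw [← star_mul_star (a + b)]
    exact mul_le_mul_of_le
      (star_le_star_iff.2 ((le_add_left' a b).trans (le_star _)))
      (star_le_star_iff.2 ((le_add_right' a b).trans (le_star _)))

theorem star_zero : star 0 = 1 :=
  le_antisymm (star_le le_rfl (by simpa using zero_le' 1)) (one_le_star 0)

theorem star_one : star 1 = 1 :=
  le_antisymm (star_le le_rfl (by simp)) (one_le_star 1)

theorem star_eq_one_add (a : Series) : star a = 1 + a * star a := by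
  apply le_antisymm
  · refine star_le (le_add_left' _ _) ?_
    exact (mul_le_mul_of_le le_rfl
      (add_le_iff.2 ⟨one_le_star a, mul_star_le a⟩)).trans (le_add_right' _ _)
  · exact add_le_iff.2 ⟨one_le_star a, mul_star_le a⟩

/-- Since (mP)^i = m^i P for i ≥ 1, a single factor P survives. This removes nested stars. -/
theorem star_mul_of_idem {m P : Series} (h1 : 1 ≤ P) (hP : P * P = P) :
    star (m * P) = 1 + m * P * star m := by
  apply le_antisymm
  · refine star_le (le_add_left' _ _) ?_
    rw [mul_add, add_le_iff]
    refine ⟨?_, ?_⟩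
    · refine le_trans ?_ (le_add_right' _ _)
      exact mul_le_mul_of_le le_rfl (one_le_star m)
    · refine le_trans ?_ (le_add_right' _ _)
      calc m * P * (m * P * star m) = m * (P * P) * (m * star m) := by ring
        _ ≤ _ := by rw [hP]; exact mul_le_mul_of_le le_rfl (mul_star_le m)
  · refine add_le_iff.2 ⟨one_le_star _, ?_⟩
    rw [mul_comm]
    refine star_mul_le (le_star _) ?_
    exact (mul_le_mul_of_le (le_mul_of_one_le_right' h1) le_rfl).trans (mul_star_le _)

/-- If a power of `a` is absorbed by `c*`, then `a* c*` is a finite sum of multiples of `c*`. -/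
theorem star_mul_star_of_pow_le {a c : Series} {m : ℕ} (hm : 0 < m) (h : a ^ m ≤ star c) :
    star a * star c = (∑ i ∈ Finset.range m, a ^ i) * star c := by
  apply le_antisymm
  · refine star_mul_le ?_ ?_
    · refine le_mul_of_one_le_left' ?_
      simpa using le_sum (fun i => a ^ i) (Finset.mem_range.2 hm)
    · rw [← mul_assoc, Finset.mul_sum, Finset.sum_mul]
      refine sum_le fun i hi => ?_
      rw [← pow_succ']
      rcases Nat.lt_or_ge (i + 1) m with h' | h'
      · exact mul_le_mul_of_le (le_sum (fun i => a ^ i) (Finset.mem_range.2 h')) le_rfl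
      · have : i + 1 = m := by have := Finset.mem_range.1 hi; omega
        rw [this]
        refine (mul_le_mul_of_le h le_rfl).trans ?_
        rw [star_mul_star]
        refine le_mul_of_one_le_left' ?_
        simpa using le_sum (fun i => a ^ i) (Finset.mem_range.2 hm)
  · exact mul_le_mul_of_le (sum_le fun i _ => pow_le_star a i) le_rfl

end Series

end MaxPlus

/-! ### Kleene stars of matrices and Gaussian elimination -/

namespace MaxPlus

theorem matStar_apply {n : ℕ} (A : Matrix (Fin n) (Fin n) Series) (i j : Fin n) :
    matStar A i j = ⨆ q : ℕ, (A ^ q) i j := rfl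

theorem one_le_matStar {n : ℕ} (A : Matrix (Fin n) (Fin n) Series) (i : Fin n) :
    1 ≤ matStar A i i := by
  have := le_iSup (fun q : ℕ => (A ^ q) i i) 0
  simpa [matStar] using this

theorem mul_matStar_le {n : ℕ} (A : Matrix (Fin n) (Fin n) Series) (i j m : Fin n) :
    A i j * matStar A j m ≤ matStar A i m := by
  rw [matStar_apply, Quantale.mul_iSup_distrib]
  refine iSup_le fun q => le_trans ?_ (le_iSup _ (q + 1))
  rw [pow_succ', Matrix.mul_apply]
  exact Series.le_sum (fun j => A i j * (A ^ q) j m) (Finset.mem_univ j)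

/-- `A* b` solves `A x ⊕ b ≤ x`. -/
theorem mulVec_matStar_mulVec_le {n : ℕ} (A : Matrix (Fin n) (Fin n) Series) (b : Fin n → Series) :
    A.mulVec ((matStar A).mulVec b) + b ≤ (matStar A).mulVec b := by
  intro i
  refine Series.add_le_iff.2 ⟨?_, ?_⟩
  · refine Series.sum_le fun j _ => ?_
    simp only [Matrix.mulVec, dotProduct, Finset.mul_sum]
    refine Series.sum_le fun m _ => ?_
    rw [← mul_assoc]
    exact (Series.mul_le_mul_of_le (mul_matStar_le A i j m) le_rfl).trans
      (Series.le_sum (fun m => matStar A i m * b m) (Finset.mem_univ m))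
  · exact (le_mul_of_one_le_left' (one_le_matStar A i)).trans
      (Series.le_sum (fun m => matStar A i m * b m) (Finset.mem_univ i))

theorem mulVec_mono {m n : ℕ} (A : Matrix (Fin m) (Fin n) Series) {x y : Fin n → Series}
    (h : x ≤ y) : A.mulVec x ≤ A.mulVec y :=
  fun _ => Finset.sum_le_sum fun j _ => Series.mul_le_mul_of_le le_rfl (h j)

/-- `A* b` is the least solution of `A x ⊕ b ≤ x`. -/
theorem matStar_mulVec_le {n : ℕ} {A : Matrix (Fin n) (Fin n) Series} {b y : Fin n → Series}
    (h : A.mulVec y + b ≤ y) : (matStar A).mulVec b ≤ y := by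
  have hb : b ≤ y := fun i => (Series.add_le_iff.1 (h i)).2
  have hA : A.mulVec y ≤ y := fun i => (Series.add_le_iff.1 (h i)).1
  have key : ∀ q : ℕ, (A ^ q).mulVec b ≤ y := by
    intro q
    induction q with
    | zero => simpa using hb
    | succ q ih =>
      rw [pow_succ', ← Matrix.mulVec_mulVec]
      exact (mulVec_mono A ih).trans hA
  intro i
  refine Series.sum_le fun j _ => ?_
  change matStar A i j * b j ≤ y i
  rw [matStar_apply, Quantale.iSup_mul_distrib]
  exact iSup_le fun q =>
    (Series.le_sum (fun j => (A ^ q) i j * b j) (Finset.mem_univ j)).trans (key q i)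

theorem matStar_mul_matStar_le {n : ℕ} (A : Matrix (Fin n) (Fin n) Series) (i j m : Fin n) :
    matStar A i j * matStar A j m ≤ matStar A i m := by
  have h : (matStar A).mulVec (fun j => matStar A j m) ≤ fun i => matStar A i m := by
    refine matStar_mulVec_le fun i => Series.add_le_iff.2 ⟨?_, le_rfl⟩
    exact Series.sum_le fun j _ => mul_matStar_le A i j m
  exact (Series.le_sum (fun j => matStar A i j * matStar A j m) (Finset.mem_univ j)).trans (h i)

/-- Gaussian elimination: over a subsemiring closed under the Kleene star, linear fixed point
inequalities have least solutions. -/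
theorem exists_least_solution (S : Subsemiring Series) (hS : ∀ a ∈ S, Series.star a ∈ S) (n : ℕ)
    (A : Matrix (Fin n) (Fin n) Series) (b : Fin n → Series) (hA : ∀ i j, A i j ∈ S)
    (hb : ∀ i, b i ∈ S) :
    ∃ x : Fin n → Series, (∀ i, x i ∈ S) ∧ A.mulVec x + b ≤ x ∧
      ∀ y, A.mulVec y + b ≤ y → x ≤ y := by
  induction n with
  | zero => exact ⟨0, fun i => i.elim0, fun i => i.elim0, fun y _ i => i.elim0⟩
  | succ n ih =>
    -- For given remaining unknowns, the least solution of the first inequality is `s` times its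
    -- other terms. Substituting it leaves a system with the Schur complement as matrix.
    set s := Series.star (A 0 0) with hs
    have hsS : s ∈ S := hS _ (hA 0 0)
    obtain ⟨x, hxS, hx, hmin⟩ := ih
      (Matrix.of fun i j => A i.succ j.succ + A i.succ 0 * s * A 0 j.succ)
      (fun i => b i.succ + A i.succ 0 * s * b 0)
      (fun i j => S.add_mem (hA _ _) (S.mul_mem (S.mul_mem (hA _ _) hsS) (hA _ _)))
      (fun i => S.add_mem (hb _) (S.mul_mem (S.mul_mem (hA _ _) hsS) (hb _)))
    have expand : ∀ (z : Fin n → Series) (i : Fin n),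
        (Matrix.of (fun i j => A i.succ j.succ + A i.succ 0 * s * A 0 j.succ) :
          Matrix (Fin n) (Fin n) Series).mulVec z i + (b i.succ + A i.succ 0 * s * b 0)
          = A i.succ 0 * (s * (∑ j : Fin n, A 0 j.succ * z j + b 0)) + ∑ j : Fin n, A i.succ j.succ * z j
            + b i.succ := by
      intro z i
      simp only [Matrix.mulVec, dotProduct, Matrix.of_apply, add_mul, Finset.sum_add_distrib,
        mul_add, Finset.mul_sum, mul_assoc]
      ring
    refine ⟨Fin.cons (s * (∑ j : Fin n, A 0 j.succ * x j + b 0)) x, ?_, ?_, ?_⟩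
    · refine Fin.cases ?_ ?_
      · exact S.mul_mem hsS
          (S.add_mem (S.sum_mem fun j _ => S.mul_mem (hA _ _) (hxS j)) (hb _))
      · simpa using hxS
    · refine Fin.cases ?_ fun i => ?_
      · simp only [Matrix.mulVec, dotProduct, Pi.add_apply, Fin.sum_univ_succ, Fin.cons_zero,
          Fin.cons_succ, add_assoc]
        refine Series.add_le_iff.2 ⟨?_, le_mul_of_one_le_left' (Series.one_le_star _)⟩
        rw [← mul_assoc]
        exact Series.mul_le_mul_of_le (Series.mul_star_le _) le_rfl
      · have := hx i
        simp only [Pi.add_apply, expand] at this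
        simpa only [Matrix.mulVec, dotProduct, Pi.add_apply, Fin.sum_univ_succ, Fin.cons_zero,
          Fin.cons_succ] using this
    · intro y hy
      have h0 : s * (∑ j : Fin n, A 0 j.succ * y j.succ + b 0) ≤ y 0 := by
        have := hy 0
        simp only [Matrix.mulVec, dotProduct, Pi.add_apply, Fin.sum_univ_succ, add_assoc] at this
        exact Series.star_mul_le (Series.add_le_iff.1 this).2 (Series.add_le_iff.1 this).1
      have hxy : x ≤ fun i => y i.succ := by
        refine hmin _ fun i => ?_
        simp only [Pi.add_apply, expand]
        have := hy i.succ
        simp only [Matrix.mulVec, dotProduct, Pi.add_apply, Fin.sum_univ_succ] at this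
        exact le_trans (add_le_add_left (add_le_add_left
          (Series.mul_le_mul_of_le le_rfl h0) _) _) this
      refine Fin.cases ?_ fun i => hxy i
      refine le_trans ?_ h0
      exact Series.mul_le_mul_of_le le_rfl (add_le_add_left (Finset.sum_le_sum fun j _ =>
        Series.mul_le_mul_of_le le_rfl (hxy j)) _)

/-- Column j of A* is the least solution whose source is the j-th unit vector, hence the solution
that elimination produces inside S. -/
theorem matStar_mem (S : Subsemiring Series) (hS : ∀ a ∈ S, Series.star a ∈ S) {n : ℕ}
    {A : Matrix (Fin n) (Fin n) Series} (hA : ∀ i j, A i j ∈ S) (i j : Fin n) :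
    matStar A i j ∈ S := by
  obtain ⟨x, hxS, hx, hmin⟩ := exists_least_solution S hS n A (Pi.single j 1) hA fun i => by
    by_cases h : i = j
    · subst h; simp
    · simp [h]
  have : (matStar A).mulVec (Pi.single j 1) = x :=
    le_antisymm (matStar_mulVec_le hx) (hmin _ (mulVec_matStar_mulVec_le A _))
  have h := congrFun this i
  rw [Matrix.mulVec_single_one] at h
  change matStar A i j = x i at h
  rw [h]
  exact hxS i

end MaxPlus

/-! ### Arithmetic of dates and ultimately periodic series -/

namespace MaxPlus

namespace ZMax

theorem cases (a : ZMax) : a = ⊥ ∨ a = ⊤ ∨ ∃ n : ℤ, a = ((n : WithTop ℤ) : ZMax) := by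
  induction a using WithBot.recBotCoe with
  | bot => exact Or.inl rfl
  | coe a =>
    induction a using WithTop.recTopCoe with
    | top => exact Or.inr (Or.inl rfl)
    | coe a => exact Or.inr (Or.inr ⟨a, rfl⟩)

theorem coe_le_coe {a b : ℤ} :
    ((a : WithTop ℤ) : ZMax) ≤ ((b : WithTop ℤ) : ZMax) ↔ a ≤ b := by norm_cast

theorem coe_add_coe (a b : ℤ) :
    ((a : WithTop ℤ) : ZMax) + ((b : WithTop ℤ) : ZMax) = (((a + b : ℤ) : WithTop ℤ) : ZMax) := rfl

theorem natCast_eq (n : ℕ) : (n : ZMax) = (((n : ℤ) : WithTop ℤ) : ZMax) := rfl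

theorem coe_ne_top (a : ℤ) : ((a : WithTop ℤ) : ZMax) ≠ ⊤ := by
  intro h
  exact WithTop.coe_ne_top (WithBot.coe_injective h)

theorem coe_ne_bot (a : ℤ) : ((a : WithTop ℤ) : ZMax) ≠ ⊥ := WithBot.coe_ne_bot

theorem add_coe_le_add_coe_iff {a b : ZMax} (c : ℤ) :
    a + ((c : WithTop ℤ) : ZMax) ≤ b + ((c : WithTop ℤ) : ZMax) ↔ a ≤ b := by
  refine ⟨fun h => ?_, fun h => by gcongr⟩
  have key : ∀ x : ZMax,
      x + ((c : WithTop ℤ) : ZMax) + (((-c : ℤ) : WithTop ℤ) : ZMax) = x := by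
    intro x
    rw [add_assoc, coe_add_coe, add_neg_cancel]
    exact add_zero x
  rw [← key a, ← key b]
  gcongr

theorem add_natCast_le_add_natCast_iff {a b : ZMax} (c : ℕ) :
    a + (c : ZMax) ≤ b + (c : ZMax) ↔ a ≤ b := add_coe_le_add_coe_iff (c : ℤ)

theorem add_coe_eq_bot_iff {a : ZMax} (c : ℤ) : a + ((c : WithTop ℤ) : ZMax) = ⊥ ↔ a = ⊥ := by
  rw [WithBot.add_eq_bot]
  simp

theorem eq_top_of_forall_natCast_le {a : ZMax} (h : ∀ n : ℕ, (n : ZMax) ≤ a) : a = ⊤ := by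
  rcases cases a with rfl | rfl | ⟨n, rfl⟩
  · exact absurd (h 0) (by simp)
  · rfl
  · have := h (n.toNat + 1)
    rw [natCast_eq, coe_le_coe] at this
    omega

theorem exists_le_add_natCast {a b : ZMax} (ha : a ≠ ⊤) (hb : b ≠ ⊥) :
    ∃ M : ℕ, a ≤ b + (M : ZMax) := by
  rcases cases a with rfl | rfl | ⟨m, rfl⟩
  · exact ⟨0, bot_le⟩
  · exact absurd rfl ha
  rcases cases b with rfl | rfl | ⟨n, rfl⟩
  · exact absurd rfl hb
  · exact ⟨0, le_top⟩
  · refine ⟨(m - n).toNat, ?_⟩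
    rw [natCast_eq, coe_add_coe, coe_le_coe]
    omega

/-- Finite dates suffice as tests because `⊤` is the supremum of the integers. -/
theorem le_of_forall_coe_le {a b : ZMax}
    (h : ∀ n : ℤ, ((n : WithTop ℤ) : ZMax) ≤ a → ((n : WithTop ℤ) : ZMax) ≤ b) : a ≤ b := by
  rcases cases a with rfl | rfl | ⟨n, rfl⟩
  · exact bot_le
  · exact (eq_top_of_forall_natCast_le fun n => h n le_top).ge
  · exact h n le_rfl

end ZMax

namespace Series

/-- `s` is null for small arguments and eventually satisfies `s (k + ν) = s k + τ` for some
`ν > 0` and `τ ≥ 0`. -/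
def IsUltPeriodic (s : Series) : Prop :=
  (∃ K₀ : ℤ, ∀ k < K₀, s k = ⊥) ∧
    ∃ (K : ℤ) (ν τ : ℕ), 0 < ν ∧ ∀ k ≥ K, s (k + ν) = s k + (τ : ZMax)

theorem iterate_period {s : Series} {K : ℤ} {ν τ : ℕ}
    (h : ∀ k ≥ K, s (k + ν) = s k + (τ : ZMax)) (m : ℕ) :
    ∀ k ≥ K, s (k + (m * ν : ℕ)) = s k + ((m * τ : ℕ) : ZMax) := by
  induction m with
  | zero => simp
  | succ m ih =>
    intro k hk
    rw [show k + ((m + 1) * ν : ℕ) = k + (m * ν : ℕ) + ν by push_cast; ring, h _ (by omega),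
      ih k hk, add_assoc, ← Nat.cast_add, add_mul, one_mul]

/-- Two ultimately periodic series have a common period length. -/
theorem exists_common_period {s t : Series} (hs : IsUltPeriodic s) (ht : IsUltPeriodic t) :
    ∃ (K : ℤ) (ν τ₁ τ₂ : ℕ), 0 < ν ∧ (∀ k ≥ K, s (k + ν) = s k + (τ₁ : ZMax)) ∧
      ∀ k ≥ K, t (k + ν) = t k + (τ₂ : ZMax) := by
  obtain ⟨-, K₁, ν₁, τ₁, hν₁, h₁⟩ := hs
  obtain ⟨-, K₂, ν₂, τ₂, hν₂, h₂⟩ := ht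
  refine ⟨max K₁ K₂, ν₂ * ν₁, ν₂ * τ₁, ν₁ * τ₂, by positivity, ?_, ?_⟩
  · exact fun k hk => iterate_period h₁ ν₂ k (le_trans (le_max_left _ _) hk)
  · intro k hk
    rw [mul_comm ν₂]
    exact iterate_period h₂ ν₁ k (le_trans (le_max_right _ _) hk)

/-- The faster growing of two series eventually dominates. -/
theorem eventually_le_of_lt {s t : Series} {K : ℤ} {ν τ₁ τ₂ : ℕ} (hν : 0 < ν)
    (hs : ∀ k ≥ K, s (k + ν) = s k + (τ₁ : ZMax)) (ht : ∀ k ≥ K, t (k + ν) = t k + (τ₂ : ZMax))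
    (hlt : τ₂ < τ₁) :
    (∀ k, s k = ⊥) ∨ (∃ k, t k = ⊤) ∨ ∃ K', ∀ k ≥ K', t k ≤ s k := by
  by_cases h1 : ∀ k, s k = ⊥
  · exact Or.inl h1
  by_cases h2 : ∃ k, t k = ⊤
  · exact Or.inr (Or.inl h2)
  right; right
  push Not at h1 h2
  obtain ⟨k₁, hk₁⟩ := h1
  set k₀ := max k₁ K
  have hs0 : s k₀ ≠ ⊥ := fun h => hk₁ (le_bot_iff.1 (h ▸ s.mono (le_max_left k₁ K)))
  obtain ⟨M, hM⟩ := ZMax.exists_le_add_natCast (h2 k₀) hs0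
  -- After m ≥ M + τ₂ periods, `s` has gained m(τ₁ - τ₂) ≥ M + τ₂ on `t`. This covers the gap M at
  -- `k₀` and the extra τ₂ from rounding k up to a full period.
  refine ⟨k₀ + ((M + τ₂) * ν : ℕ), fun k hk => ?_⟩
  have hdecomp : ∃ m ρ : ℕ, ρ < ν ∧ k = k₀ + (m * ν : ℕ) + ρ ∧ M + τ₂ ≤ m := by
    refine ⟨(k - k₀).toNat / ν, (k - k₀).toNat % ν, Nat.mod_lt _ hν, ?_, ?_⟩
    · have := Nat.div_add_mod' (k - k₀).toNat ν
      omega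
    · rw [Nat.le_div_iff_mul_le hν]
      omega
  obtain ⟨m, ρ, hρ, rfl, hm⟩ := hdecomp
  calc t (k₀ + (m * ν : ℕ) + ρ) ≤ t (k₀ + ((m + 1) * ν : ℕ)) :=
        t.mono (by push_cast [add_mul]; omega)
    _ = t k₀ + (((m + 1) * τ₂ : ℕ) : ZMax) := iterate_period ht _ _ (le_max_right _ _)
    _ ≤ s k₀ + (M : ZMax) + (((m + 1) * τ₂ : ℕ) : ZMax) := by gcongr
    _ ≤ s k₀ + ((m * τ₁ : ℕ) : ZMax) := by
        rw [add_assoc, ← Nat.cast_add]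
        have : M + (m + 1) * τ₂ ≤ m * τ₁ := by nlinarith
        gcongr
    _ = s (k₀ + (m * ν : ℕ)) := (iterate_period hs _ _ (le_max_right _ _)).symm
    _ ≤ _ := s.mono (by omega)

/-- Two ultimately periodic series are eventually comparable or have a common period. -/
theorem IsUltPeriodic.comparable {s t : Series} (hs : IsUltPeriodic s) (ht : IsUltPeriodic t) :
    (∃ K, ∀ k ≥ K, s k ≤ t k) ∨ (∃ K, ∀ k ≥ K, t k ≤ s k) ∨
      ∃ (K : ℤ) (ν τ : ℕ), 0 < ν ∧ (∀ k ≥ K, s (k + ν) = s k + (τ : ZMax)) ∧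
        ∀ k ≥ K, t (k + ν) = t k + (τ : ZMax) := by
  obtain ⟨K, ν, τ₁, τ₂, hν, h₁, h₂⟩ := exists_common_period hs ht
  rcases lt_trichotomy τ₁ τ₂ with h | rfl | h
  · rcases eventually_le_of_lt hν h₂ h₁ h with h | ⟨K, h⟩ | ⟨K, h⟩
    · exact Or.inr (Or.inl ⟨0, fun k _ => (h k).trans_le bot_le⟩)
    · exact Or.inr (Or.inl ⟨K, fun k hk => le_top.trans (h.ge.trans (s.mono hk))⟩)
    · exact Or.inl ⟨K, h⟩
  · exact Or.inr (Or.inr ⟨K, ν, τ₁, hν, h₁, h₂⟩)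
  · rcases eventually_le_of_lt hν h₁ h₂ h with h | ⟨K, h⟩ | ⟨K, h⟩
    · exact Or.inl ⟨0, fun k _ => (h k).trans_le bot_le⟩
    · exact Or.inl ⟨K, fun k hk => le_top.trans (h.ge.trans (t.mono hk))⟩
    · exact Or.inr (Or.inl ⟨K, h⟩)

/-- Serves the case where one of two series eventually dominates: their sum and meet then eventually
coincide with one of them. -/
theorem IsUltPeriodic.congr {s t : Series} (hs : IsUltPeriodic s) (h₀ : ∃ K₀, ∀ k < K₀, t k = ⊥)
    (h : ∃ K, ∀ k ≥ K, t k = s k) : IsUltPeriodic t := by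
  obtain ⟨-, K, ν, τ, hν, hK⟩ := hs
  obtain ⟨K', h'⟩ := h
  refine ⟨h₀, max K K', ν, τ, hν, fun k hk => ?_⟩
  have := le_max_left K K'
  have := le_max_right K K'
  rw [h' _ (by omega), h' _ (by omega), hK _ (by omega)]

theorem IsUltPeriodic.sup {s t : Series} (hs : IsUltPeriodic s) (ht : IsUltPeriodic t) :
    IsUltPeriodic (s ⊔ t) := by
  have h₀ : ∃ K₀ : ℤ, ∀ k < K₀, (s ⊔ t) k = ⊥ := by
    obtain ⟨K₁, h₁⟩ := hs.1
    obtain ⟨K₂, h₂⟩ := ht.1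
    refine ⟨min K₁ K₂, fun k hk => ?_⟩
    rw [sup_apply, h₁ k (hk.trans_le (min_le_left _ _)), h₂ k (hk.trans_le (min_le_right _ _)),
      sup_idem]
  rcases hs.comparable ht with ⟨K, h⟩ | ⟨K, h⟩ | ⟨K, ν, τ, hν, h₁, h₂⟩
  · exact ht.congr h₀ ⟨K, fun k hk => sup_eq_right.2 (h k hk)⟩
  · exact hs.congr h₀ ⟨K, fun k hk => sup_eq_left.2 (h k hk)⟩
  · refine ⟨h₀, K, ν, τ, hν, fun k hk => ?_⟩
    rw [sup_apply, sup_apply, h₁ k hk, h₂ k hk, max_add_add_right]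

theorem inf_apply (s t : Series) (k : ℤ) : (s ⊓ t) k = s k ⊓ t k := rfl

theorem IsUltPeriodic.inf {s t : Series} (hs : IsUltPeriodic s) (ht : IsUltPeriodic t) :
    IsUltPeriodic (s ⊓ t) := by
  have h₀ : ∃ K₀ : ℤ, ∀ k < K₀, (s ⊓ t) k = ⊥ := by
    obtain ⟨K₁, h₁⟩ := hs.1
    exact ⟨K₁, fun k hk => by rw [inf_apply, h₁ k hk, bot_inf_eq]⟩
  rcases hs.comparable ht with ⟨K, h⟩ | ⟨K, h⟩ | ⟨K, ν, τ, hν, h₁, h₂⟩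
  · exact hs.congr h₀ ⟨K, fun k hk => inf_eq_left.2 (h k hk)⟩
  · exact ht.congr h₀ ⟨K, fun k hk => inf_eq_right.2 (h k hk)⟩
  · refine ⟨h₀, K, ν, τ, hν, fun k hk => ?_⟩
    rw [inf_apply, inf_apply, h₁ k hk, h₂ k hk, min_add_add_right]

/-! ### Monomials and their stars -/

theorem monomial_apply (t n k : ℤ) :
    monomial t n k = if n ≤ k then ((t : WithTop ℤ) : ZMax) else ⊥ := rfl

theorem monomial_le_iff {t n : ℤ} {s : Series} :
    monomial t n ≤ s ↔ ((t : WithTop ℤ) : ZMax) ≤ s n := by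
  refine ⟨fun h => by simpa [monomial_apply] using le_def.1 h n, fun h => le_def.2 fun k => ?_⟩
  rw [monomial_apply]
  split_ifs with hk
  · exact h.trans (s.mono hk)
  · exact bot_le

/-- Monotonicity of `s` makes j = n the best index in the Cauchy product. -/
theorem monomial_mul_apply (t n : ℤ) (s : Series) (k : ℤ) :
    (monomial t n * s) k = s (k - n) + ((t : WithTop ℤ) : ZMax) := by
  rw [mul_apply]
  apply le_antisymm
  · refine iSup_le fun j => ?_
    rw [monomial_apply]
    split_ifs with h
    · rw [add_comm]
      gcongr
      exact s.mono (by omega)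
    · simp
  · refine le_trans ?_ (le_iSup _ n)
    simp [monomial_apply, add_comm]

theorem monomial_mul_monomial (t n t' n' : ℤ) :
    monomial t n * monomial t' n' = monomial (t + t') (n + n') := by
  ext k
  rw [monomial_mul_apply, monomial_apply, monomial_apply]
  split_ifs
  · rw [ZMax.coe_add_coe, add_comm]
  · omega
  · omega
  · rfl

theorem one_eq_monomial : (1 : Series) = monomial 0 0 := rfl

theorem monomial_pow (t n : ℤ) (i : ℕ) : monomial t n ^ i = monomial (i * t) (i * n) := by
  induction i with
  | zero => simp [one_eq_monomial]
  | succ i ih =>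
    rw [pow_succ, ih, monomial_mul_monomial]
    push_cast
    ring_nf

theorem IsUltPeriodic.monomial_mul {s : Series} (hs : IsUltPeriodic s) (t n : ℤ) :
    IsUltPeriodic (monomial t n * s) := by
  obtain ⟨⟨K₀, h₀⟩, K, ν, τ, hν, h⟩ := hs
  refine ⟨⟨K₀ + n, fun k hk => ?_⟩, K + n, ν, τ, hν, fun k hk => ?_⟩
  · rw [monomial_mul_apply, h₀ _ (by omega), WithBot.bot_add]
  · rw [monomial_mul_apply, monomial_mul_apply, show k + ν - n = k - n + ν by ring,
      h _ (by omega), add_right_comm]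

theorem isUltPeriodic_zero : IsUltPeriodic 0 :=
  ⟨⟨0, fun _ _ => rfl⟩, 0, 1, 0, one_pos, fun _ _ => rfl⟩

theorem isUltPeriodic_one : IsUltPeriodic 1 := by
  refine ⟨⟨0, fun k hk => ?_⟩, 0, 1, 0, one_pos, fun k hk => ?_⟩
  · rw [one_apply, if_neg (by omega)]
  · rw [one_apply, one_apply, if_pos (by omega), if_pos (by omega)]
    simp

theorem isUltPeriodic_sum {ι : Type*} {F : Finset ι} {f : ι → Series}
    (h : ∀ i ∈ F, IsUltPeriodic (f i)) : IsUltPeriodic (∑ i ∈ F, f i) :=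
  Finset.sum_induction f IsUltPeriodic (fun _ _ => IsUltPeriodic.sup) isUltPeriodic_zero h

theorem star_monomial_apply_of_neg (τ ν : ℕ) {k : ℤ} (hk : k < 0) :
    star (monomial τ ν) k = ⊥ := by
  rw [star, iSup_apply, iSup_eq_bot]
  intro i
  rw [monomial_pow, monomial_apply, if_neg]
  have : (0 : ℤ) ≤ i * ν := by positivity
  omega

theorem zero_le_star_monomial_apply (τ ν : ℕ) {k : ℤ} (hk : 0 ≤ k) :
    0 ≤ star (monomial τ ν) k := by
  have := le_def.1 (one_le_star (monomial τ ν)) k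
  rwa [one_apply, if_pos hk] at this

theorem isUltPeriodic_star_monomial (τ ν : ℕ) : IsUltPeriodic (star (monomial τ ν)) := by
  refine ⟨⟨0, fun k hk => star_monomial_apply_of_neg τ ν hk⟩, ?_⟩
  rcases Nat.eq_zero_or_pos ν with rfl | hν
  · rcases Nat.eq_zero_or_pos τ with rfl | hτ
    · have : star (monomial (0 : ℕ) (0 : ℕ)) = 1 := star_one
      rw [this]
      exact isUltPeriodic_one.2
    -- A delay without tokens accumulates the dates iτ at index 0, so the star jumps to `⊤` and any
    -- period fits.
    · have htop : ∀ k ≥ 0, star (monomial τ (0 : ℕ)) k = ⊤ := by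
        refine fun k hk => ZMax.eq_top_of_forall_natCast_le fun i => ?_
        have := le_def.1 (pow_le_star (monomial τ (0 : ℕ)) i) k
        rw [monomial_pow, monomial_apply, if_pos (by simpa using hk)] at this
        refine le_trans ?_ this
        rw [ZMax.natCast_eq, ZMax.coe_le_coe]
        nlinarith
      refine ⟨0, 1, 0, one_pos, fun k hk => ?_⟩
      rw [htop k hk, htop _ (by omega)]
      rfl
  · refine ⟨0, ν, τ, hν, fun k hk => ?_⟩
    -- Evaluated at k + ν, the equation r* = e ⊕ r r* gives r*(k + ν) = max(0, r*(k) + τ), and the 0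
    -- is absorbed.
    conv_lhs => rw [star_eq_one_add]
    rw [add_def, sup_apply, monomial_mul_apply, add_sub_cancel_right, sup_eq_right.2]
    · rfl
    · change _ ≤ _ + (τ : ZMax)
      rw [one_apply, if_pos (by omega)]
      calc (0 : ZMax) ≤ (τ : ZMax) := by
            rw [ZMax.natCast_eq]
            exact ZMax.coe_le_coe.2 (by omega)
        _ = 0 + (τ : ZMax) := (zero_add _).symm
        _ ≤ _ := by
            gcongr
            exact zero_le_star_monomial_apply τ ν hk

theorem IsPeriodic.isUltPeriodic {s : Series} (hs : IsPeriodic s) : IsUltPeriodic s := by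
  obtain ⟨F, G, τ, ν, -, rfl⟩ := hs
  refine IsUltPeriodic.sup ?_ ?_
  · refine isUltPeriodic_sum fun m _ => ?_
    rw [← mul_one (monomial _ _)]
    exact isUltPeriodic_one.monomial_mul _ _
  · rw [polynomial, Finset.sum_mul]
    exact isUltPeriodic_sum fun m _ => (isUltPeriodic_star_monomial τ ν).monomial_mul _ _

end Series

end MaxPlus

/-! ### Normal forms, slopes and products of periodic series -/

namespace MaxPlus

open scoped ENNReal

/-- The integer value of a finite date, `0` for the infinite dates. -/
def ZMax.toInt (a : ZMax) : ℤ := (a.unbotD 0).untopD 0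

theorem ZMax.coe_toInt {a : ZMax} (h : a ≠ ⊥) (h' : a ≠ ⊤) : ((a.toInt : WithTop ℤ) : ZMax) = a := by
  rcases ZMax.cases a with rfl | rfl | ⟨n, rfl⟩
  · exact absurd rfl h
  · exact absurd rfl h'
  · rfl

namespace Series

open Classical in
/-- The monomials `s(k) γᵏ` with `a ≤ k < b` and `s(k)` finite. -/
noncomputable def window (s : Series) (a b : ℤ) : Finset (ℤ × ℤ) :=
  ((Finset.Ico a b).filter fun k => s k ≠ ⊥ ∧ s k ≠ ⊤).image fun k => ((s k).toInt, k)

theorem mem_window_iff {s : Series} {a b : ℤ} {m : ℤ × ℤ} :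
    m ∈ window s a b ↔ a ≤ m.2 ∧ m.2 < b ∧ s m.2 = ((m.1 : WithTop ℤ) : ZMax) := by
  obtain ⟨t, n⟩ := m
  simp only [window, Finset.mem_image, Finset.mem_filter, Finset.mem_Ico, Prod.mk.injEq]
  constructor
  · rintro ⟨k, ⟨⟨h1, h2⟩, h3, h4⟩, rfl, rfl⟩
    exact ⟨h1, h2, (ZMax.coe_toInt h3 h4).symm⟩
  · rintro ⟨h1, h2, h3⟩
    exact ⟨n, ⟨⟨h1, h2⟩, h3 ▸ ZMax.coe_ne_bot t, h3 ▸ ZMax.coe_ne_top t⟩, by rw [h3]; rfl, rfl⟩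

theorem coe_le_polynomial {F : Finset (ℤ × ℤ)} {m : ℤ × ℤ} (hm : m ∈ F) :
    ((m.1 : WithTop ℤ) : ZMax) ≤ polynomial F m.2 :=
  monomial_le_iff.1 (le_sum (fun m : ℤ × ℤ => monomial m.1 m.2) hm)

theorem polynomial_le_iff {F : Finset (ℤ × ℤ)} {s : Series} :
    polynomial F ≤ s ↔ ∀ m ∈ F, ((m.1 : WithTop ℤ) : ZMax) ≤ s m.2 :=
  ⟨fun h _ hm => (coe_le_polynomial hm).trans (le_def.1 h _),
    fun h => sum_le fun m hm => monomial_le_iff.2 (h m hm)⟩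

theorem coe_le_polynomial_mul_star {G : Finset (ℤ × ℤ)} {m : ℤ × ℤ} (hm : m ∈ G) (τ ν i : ℕ) :
    (((m.1 + i * τ : ℤ) : WithTop ℤ) : ZMax) ≤
      (polynomial G * star (monomial τ ν)) (m.2 + i * ν) := by
  rw [← monomial_le_iff, ← monomial_mul_monomial, ← monomial_pow]
  exact mul_le_mul_of_le (le_sum (fun m : ℤ × ℤ => monomial m.1 m.2) hm) (pow_le_star _ _)

theorem polynomial_mul_star_le_iff {G : Finset (ℤ × ℤ)} {τ ν : ℕ} {s : Series} :
    polynomial G * star (monomial τ ν) ≤ s ↔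
      ∀ m ∈ G, ∀ i : ℕ, (((m.1 + i * τ : ℤ) : WithTop ℤ) : ZMax) ≤ s (m.2 + i * ν) := by
  refine ⟨fun h m hm i => (coe_le_polynomial_mul_star hm τ ν i).trans (le_def.1 h _), fun h => ?_⟩
  rw [polynomial, Finset.sum_mul]
  refine sum_le fun m hm => ?_
  rw [star, Quantale.mul_iSup_distrib]
  refine iSup_le fun i => ?_
  rw [monomial_pow, monomial_mul_monomial, monomial_le_iff]
  exact h m hm i

/-- The periodic part stays below `s` and reaches it from K on. The finitely many values between K₀
and K supply p; they must avoid `⊤`, since p has finite coefficients only. -/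
theorem eq_polynomial_add {s : Series} {K₀ K : ℤ} {G : Finset (ℤ × ℤ)} {τ ν : ℕ}
    (h₀ : ∀ k < K₀, s k = ⊥) (hfin : ∀ k < K, s k ≠ ⊤)
    (hG : polynomial G * star (monomial τ ν) ≤ s)
    (hK : ∀ k ≥ K, s k ≤ (polynomial G * star (monomial τ ν)) k) :
    s = polynomial (window s K₀ K) + polynomial G * star (monomial τ ν) := by
  apply le_antisymm
  · refine le_def.2 fun k => ?_
    rcases lt_or_ge k K with hk | hk
    · rcases ZMax.cases (s k) with h | h | ⟨n, h⟩
      · exact h.trans_le bot_le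
      · exact absurd h (hfin k hk)
      · by_cases hk0 : k < K₀
        · exact (h₀ k hk0).trans_le bot_le
        have hm : ((n, k) : ℤ × ℤ) ∈ window s K₀ K := mem_window_iff.2 ⟨by simpa using hk0, hk, h⟩
        rw [h]
        exact (coe_le_polynomial hm).trans (le_def.1 (le_add_left' _ _) k)
    · exact (hK k hk).trans (le_def.1 (le_add_right' _ _) k)
  · exact add_le_iff.2 ⟨polynomial_le_iff.2 fun m hm => (mem_window_iff.1 hm).2.2.ge, hG⟩

/-- There is a first index K with value `⊤`, as `s` is null for small arguments. The tail is then
γ^K (1γ⁰)*, of slope 0/1. -/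
theorem IsUltPeriodic.hasSlope_zero {s : Series} (hs : IsUltPeriodic s) (htop : ∃ k, s k = ⊤) :
    HasSlope s 0 := by
  obtain ⟨⟨K₀, h₀⟩, -⟩ := hs
  obtain ⟨K, hK, hmin⟩ := Int.exists_least_of_bdd (P := fun k => s k = ⊤)
    ⟨K₀, fun k (hk : s k = ⊤) => by
      by_contra! h
      rw [h₀ k h] at hk
      exact absurd hk bot_ne_top⟩ htop
  refine ⟨window s K₀ K, {(0, K)}, 1, 0, Or.inl one_ne_zero, Finset.singleton_nonempty _,
    eq_polynomial_add h₀ (fun k hk h => absurd (hmin k h) (by omega)) ?_ ?_, by simp⟩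
  · rw [polynomial_mul_star_le_iff]
    intro m hm i
    rw [Finset.mem_singleton.1 hm]
    simp [hK]
  · intro k hk
    refine le_top.trans (ZMax.eq_top_of_forall_natCast_le fun i => ?_).ge
    refine le_trans ?_ (mono _ hk)
    simpa [ZMax.natCast_eq] using
      coe_le_polynomial_mul_star (Finset.mem_singleton_self ((0, K) : ℤ × ℤ)) 1 0 i

theorem IsUltPeriodic.hasSlope_div {s : Series} (hs : IsUltPeriodic s) (hne : s ≠ 0)
    (htop : ∀ k, s k ≠ ⊤) {K : ℤ} {ν τ : ℕ} (hν : 0 < ν)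
    (h : ∀ k ≥ K, s (k + ν) = s k + (τ : ZMax)) : HasSlope s ((ν : ℝ≥0∞) / (τ : ℝ≥0∞)) := by
  obtain ⟨⟨K₀, h₀⟩, -⟩ := hs
  -- Starting the period at a finite value makes q nonzero and gives a monomial for every residue in
  -- one period.
  obtain ⟨K', hKK', hK'⟩ : ∃ K' ≥ K, s K' ≠ ⊥ := by
    by_contra! hbot
    refine hne (ext fun k => le_bot_iff.1 ?_)
    exact (s.mono (le_max_left k K)).trans (hbot _ (le_max_right k K)).le
  have hiter : ∀ i : ℕ, ∀ k ≥ K', s (k + i * ν) = s k + (((i * τ : ℤ) : WithTop ℤ) : ZMax) := by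
    intro i k hk
    exact_mod_cast iterate_period h i k (hKK'.trans hk)
  refine ⟨window s K₀ K', window s K' (K' + ν), τ, ν, Or.inr hν.ne', ?_,
    eq_polynomial_add h₀ (fun k _ => htop k) ?_ ?_, rfl⟩
  · exact ⟨((s K').toInt, K'), mem_window_iff.2
      ⟨le_rfl, by simpa using hν, (ZMax.coe_toInt hK' (htop K')).symm⟩⟩
  · rw [polynomial_mul_star_le_iff]
    intro m hm i
    obtain ⟨h1, -, h3⟩ := mem_window_iff.1 hm
    rw [hiter i _ h1, h3, ZMax.coe_add_coe]
  · intro k hk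
    have hdecomp : ∃ m ρ : ℕ, ρ < ν ∧ k = K' + ρ + m * ν := by
      refine ⟨(k - K').toNat / ν, (k - K').toNat % ν, Nat.mod_lt _ hν, ?_⟩
      have := Nat.div_add_mod' (k - K').toNat ν
      rw [← Nat.cast_mul]
      omega
    obtain ⟨m, ρ, hρ, rfl⟩ := hdecomp
    have hbot : s (K' + ρ) ≠ ⊥ := fun hb => hK' (le_bot_iff.1 (hb ▸ s.mono (by omega)))
    have hmem : (((s (K' + ρ)).toInt, K' + ρ) : ℤ × ℤ) ∈ window s K' (K' + ν) :=
      mem_window_iff.2 ⟨by simp, by simpa using hρ, (ZMax.coe_toInt hbot (htop _)).symm⟩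
    rw [hiter m _ (by omega)]
    have := coe_le_polynomial_mul_star hmem τ ν m
    rwa [← ZMax.coe_add_coe, ZMax.coe_toInt hbot (htop _)] at this

theorem HasSlope.isPeriodic {s : Series} {σ : ℝ≥0∞} (h : HasSlope s σ) : IsPeriodic s := by
  obtain ⟨F, G, τ, ν, h1, -, h2, -⟩ := h
  exact ⟨F, G, τ, ν, h1, h2⟩

theorem IsUltPeriodic.isPeriodic {s : Series} (hs : IsUltPeriodic s) : IsPeriodic s := by
  by_cases h0 : s = 0
  · exact ⟨∅, ∅, 1, 0, Or.inl one_ne_zero, by simp [h0, polynomial]⟩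
  by_cases htop : ∃ k, s k = ⊤
  · exact (hs.hasSlope_zero htop).isPeriodic
  · push Not at htop
    obtain ⟨-, K, ν, τ, hν, h⟩ := id hs
    exact (hs.hasSlope_div h0 htop hν h).isPeriodic

/-- Of two causal monomials, one has a power that is absorbed by the star of the other. -/
theorem exists_pow_le_star (τ ν τ' ν' : ℕ) :
    (∃ m : ℕ, 0 < m ∧ monomial τ ν ^ m ≤ star (monomial τ' ν')) ∨
      ∃ m : ℕ, 0 < m ∧ monomial τ' ν' ^ m ≤ star (monomial τ ν) := by
  have key : ∀ τ ν τ' ν' : ℕ, 0 < ν' → ν' * τ ≤ ν * τ' →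
      ∃ m : ℕ, 0 < m ∧ monomial τ ν ^ m ≤ star (monomial τ' ν') := by
    intro τ ν τ' ν' hν' h
    -- The ν'-th power of τγ^ν and the ν-th power of τ'γ^ν' have the same exponent νν', so only
    -- their dates ν'τ ≤ ντ' are compared.
    refine ⟨ν', hν', le_trans ?_ (pow_le_star _ ν)⟩
    rw [monomial_pow, monomial_pow, monomial_le_iff, monomial_apply, if_pos (by rw [mul_comm]),
      ZMax.coe_le_coe]
    exact_mod_cast h
  have key₀ : ∀ τ ν τ' : ℕ, 0 < τ' →
      ∃ m : ℕ, 0 < m ∧ monomial τ ν ^ m ≤ star (monomial τ' (0 : ℕ)) := by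
    intro τ ν τ' hτ'
    -- The τ-th power of τ'γ⁰ has date ττ' ≥ τ at index 0 ≤ ν.
    refine ⟨1, one_pos, le_trans ?_ (pow_le_star _ τ)⟩
    rw [pow_one, monomial_pow, monomial_le_iff, monomial_apply, if_pos (by simp), ZMax.coe_le_coe]
    nlinarith
  have key₁ : ∀ τ ν : ℕ,
      ∃ m : ℕ, 0 < m ∧ monomial (0 : ℕ) (0 : ℕ) ^ m ≤ star (monomial τ ν) :=
    fun τ ν => ⟨1, one_pos, by rw [pow_one]; exact one_le_star _⟩
  rcases Nat.eq_zero_or_pos ν with rfl | hν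
  · rcases Nat.eq_zero_or_pos τ with rfl | hτ
    · exact Or.inl (key₁ _ _)
    · exact Or.inr (key₀ _ _ _ hτ)
  rcases Nat.eq_zero_or_pos ν' with rfl | hν'
  · rcases Nat.eq_zero_or_pos τ' with rfl | hτ'
    · exact Or.inr (key₁ _ _)
    · exact Or.inl (key₀ _ _ _ hτ')
  rcases le_total (ν' * τ) (ν * τ') with h | h
  · exact Or.inl (key _ _ _ _ hν' h)
  · exact Or.inr (key _ _ _ _ hν h)

theorem IsUltPeriodic.polynomial_mul {s : Series} (hs : IsUltPeriodic s) (F : Finset (ℤ × ℤ)) :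
    IsUltPeriodic (polynomial F * s) := by
  rw [polynomial, Finset.sum_mul]
  exact isUltPeriodic_sum fun m _ => hs.monomial_mul _ _

theorem isUltPeriodic_star_mul_star (τ ν τ' ν' : ℕ) :
    IsUltPeriodic (star (monomial τ ν) * star (monomial τ' ν')) := by
  have key : ∀ τ ν τ' ν' m : ℕ, 0 < m → monomial τ ν ^ m ≤ star (monomial τ' ν') →
      IsUltPeriodic (star (monomial τ ν) * star (monomial τ' ν')) := by
    intro τ ν τ' ν' m hm h
    rw [star_mul_star_of_pow_le hm h, Finset.sum_mul]
    refine isUltPeriodic_sum fun i _ => ?_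
    rw [monomial_pow]
    exact (isUltPeriodic_star_monomial τ' ν').monomial_mul _ _
  rcases exists_pow_le_star τ ν τ' ν' with ⟨m, hm, h⟩ | ⟨m, hm, h⟩
  · exact key _ _ _ _ m hm h
  · rw [mul_comm]
    exact key _ _ _ _ m hm h

/-- Expanding both normal forms leaves one new kind of term, a product of two stars, where one star
reduces to finitely many powers. -/
theorem IsUltPeriodic.mul {s t : Series} (hs : IsUltPeriodic s) (ht : IsUltPeriodic t) :
    IsUltPeriodic (s * t) := by
  obtain ⟨F, G, τ, ν, -, rfl⟩ := hs.isPeriodic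
  obtain ⟨F', G', τ', ν', -, rfl⟩ := id ht.isPeriodic
  rw [add_mul]
  refine (ht.polynomial_mul F).sup ?_
  rw [mul_assoc]
  refine IsUltPeriodic.polynomial_mul ?_ G
  rw [mul_add]
  refine IsUltPeriodic.sup ?_ ?_
  · rw [mul_comm]
    exact (isUltPeriodic_star_monomial τ ν).polynomial_mul F'
  · rw [mul_left_comm]
    exact (isUltPeriodic_star_mul_star τ ν τ' ν').polynomial_mul G'

/-! ### The semirings of periodic and of rational series -/

/-- The subsemiring of periodic series. -/
noncomputable def periodic : Subsemiring Series where
  carrier := {s | IsUltPeriodic s}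
  mul_mem' := IsUltPeriodic.mul
  one_mem' := isUltPeriodic_one
  add_mem' := IsUltPeriodic.sup
  zero_mem' := isUltPeriodic_zero

/-- The causal monomials `τ γ^ν` with `τ, ν ≥ 0` and their stars. -/
def rationalGenerators : Set Series :=
  {s | ∃ τ ν : ℕ, s = monomial τ ν ∨ s = star (monomial τ ν)}

/-- The subsemiring generated by the causal monomials and their stars. -/
noncomputable def rational : Subsemiring Series := Subsemiring.closure rationalGenerators

theorem monomial_mem_rational (τ ν : ℕ) : monomial τ ν ∈ rational :=
  Subsemiring.subset_closure ⟨τ, ν, Or.inl rfl⟩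

theorem star_monomial_mem_rational (τ ν : ℕ) : star (monomial τ ν) ∈ rational :=
  Subsemiring.subset_closure ⟨τ, ν, Or.inr rfl⟩

theorem rational_le_periodic : rational ≤ periodic := by
  refine Subsemiring.closure_le.2 ?_
  rintro s ⟨τ, ν, rfl | rfl⟩
  · change IsUltPeriodic _
    rw [← mul_one (monomial _ _)]
    exact isUltPeriodic_one.monomial_mul _ _
  · exact isUltPeriodic_star_monomial τ ν

/-- Products of stars are idempotent and at least e, so collecting the monomials yields the shape
needed by `star_mul_of_idem`. -/
theorem exists_eq_monomial_mul {x : Series} (hx : x ∈ Submonoid.closure rationalGenerators) :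
    ∃ (τ ν : ℕ) (P : Series), P ∈ rational ∧ 1 ≤ P ∧ P * P = P ∧ x = monomial τ ν * P := by
  induction hx using Submonoid.closure_induction with
  | mem x hx =>
    obtain ⟨τ, ν, rfl | rfl⟩ := hx
    · exact ⟨τ, ν, 1, one_mem _, le_rfl, one_mul 1, (mul_one _).symm⟩
    · exact ⟨0, 0, star (monomial τ ν), star_monomial_mem_rational τ ν, one_le_star _,
        star_mul_star _, (one_mul _).symm⟩
  | one => exact ⟨0, 0, 1, one_mem _, le_rfl, one_mul 1, (one_mul 1).symm⟩
  | mul x y _ _ hx hy =>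
    obtain ⟨τ, ν, P, hP, hP1, hPP, rfl⟩ := hx
    obtain ⟨τ', ν', Q, hQ, hQ1, hQQ, rfl⟩ := hy
    refine ⟨τ + τ', ν + ν', P * Q, mul_mem hP hQ, one_le_mul hP1 hQ1, ?_, ?_⟩
    · rw [mul_mul_mul_comm, hPP, hQQ]
    · push_cast
      rw [mul_mul_mul_comm, monomial_mul_monomial]

/-- Stars turn sums into products, which leaves products of generators. Causality matters: (γ⁻¹)* is
0 everywhere, so periodic series are not closed under star. -/
theorem star_mem_rational {a : Series} (ha : a ∈ rational) : star a ∈ rational := by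
  rw [rational, Subsemiring.mem_closure_iff] at ha
  induction ha using AddSubmonoid.closure_induction with
  | mem x hx =>
    obtain ⟨τ, ν, P, hP, hP1, hPP, rfl⟩ := exists_eq_monomial_mul hx
    rw [star_mul_of_idem hP1 hPP]
    exact add_mem (one_mem _) (mul_mem (mul_mem (monomial_mem_rational τ ν) hP)
      (star_monomial_mem_rational τ ν))
  | zero =>
    rw [star_zero]
    exact one_mem _
  | add x y _ _ hx hy =>
    rw [star_add]
    exact mul_mem hx hy

end Series

end MaxPlus

/-! ### Residuals of periodic series -/

namespace MaxPlus

open Quantale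

theorem ZMax.eq_of_forall_coe_le_iff {a b : ZMax}
    (h : ∀ n : ℤ, ((n : WithTop ℤ) : ZMax) ≤ a ↔ ((n : WithTop ℤ) : ZMax) ≤ b) : a = b :=
  le_antisymm (ZMax.le_of_forall_coe_le fun n => (h n).1)
    (ZMax.le_of_forall_coe_le fun n => (h n).2)

namespace Series

theorem exists_apply_ne_bot {s : Series} (hs : s ≠ 0) : ∃ k, s k ≠ ⊥ := by
  by_contra! h
  exact hs (ext h)

theorem coe_le_residual_apply_iff {a b : Series} {n q : ℤ} :
    ((n : WithTop ℤ) : ZMax) ≤ (a ⇨ₗ b) q ↔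
      ∀ k, a (k - q) + ((n : WithTop ℤ) : ZMax) ≤ b k := by
  rw [← monomial_le_iff, leftMulResiduation_le_iff_mul_le, le_def]
  simp only [monomial_mul_apply]

/-- The residual of an ultimately periodic series by a nonzero one is ultimately periodic. -/
theorem IsUltPeriodic.residual {a b : Series} (hb : IsUltPeriodic b) (ha : IsUltPeriodic a)
    (hne : a ≠ 0) : IsUltPeriodic (a ⇨ₗ b) := by
  obtain ⟨⟨K₀, h₀⟩, K, ν, τ, hν, h⟩ := hb
  obtain ⟨⟨J₀, hJ₀⟩, -⟩ := ha
  obtain ⟨j, hj⟩ := exists_apply_ne_bot hne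
  -- For q < K₀ - j, the constraint at k = q + j forces a finite date below `⊥`, since `a j ≠ ⊥`.
  -- For q ≥ K - J₀, constraints with k - q < J₀ are void and all others have k ≥ K, where `b` is
  -- periodic; shifting k by ν matches those at q + ν with those at q.
  refine ⟨⟨K₀ - j, fun q hq => ?_⟩, K - J₀, ν, τ, hν, fun q hq => ?_⟩
  · refine le_bot_iff.1 (ZMax.le_of_forall_coe_le fun n hn => ?_)
    have := coe_le_residual_apply_iff.1 hn (q + j)
    rw [h₀ _ (by omega), add_sub_cancel_left, le_bot_iff, ZMax.add_coe_eq_bot_iff] at this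
    exact absurd this hj
  · refine ZMax.eq_of_forall_coe_le_iff fun n => ?_
    have hn : ((n : WithTop ℤ) : ZMax) = (((n - τ : ℤ) : WithTop ℤ) : ZMax) + (τ : ZMax) := by
      rw [ZMax.natCast_eq, ZMax.coe_add_coe, sub_add_cancel]
    conv_rhs => rw [hn, ZMax.add_natCast_le_add_natCast_iff]
    rw [coe_le_residual_apply_iff, coe_le_residual_apply_iff,
      ← (Equiv.addRight (ν : ℤ)).forall_congr_right]
    refine forall_congr' fun k => ?_
    rw [Equiv.coe_addRight, add_sub_add_right_eq_sub]
    rcases lt_or_ge (k - q) J₀ with hk | hk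
    · simp [hJ₀ _ hk]
    · rw [h k (by omega), hn, ← add_assoc, ZMax.add_natCast_le_add_natCast_iff]

theorem residual_zero (b : Series) : (0 : Series) ⇨ₗ b = ⊤ :=
  top_le_iff.1 (leftMulResiduation_le_iff_mul_le.2 (by rw [mul_zero]; exact zero_le' b))

theorem top_apply (k : ℤ) : (⊤ : Series) k = ⊤ := rfl

/-- A product of `⊤` with a nonzero series is `⊤` everywhere, whereas `b` vanishes for small
arguments. Thus a `⊤` entry of L only meets null outputs. -/
theorem eq_zero_of_top_mul_le {a b : Series} (hb : IsUltPeriodic b) (h : ⊤ * a ≤ b) : a = 0 := by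
  obtain ⟨⟨K₀, h₀⟩, -⟩ := hb
  ext k
  have := le_def.1 h (K₀ - 1)
  rw [h₀ _ (by omega), mul_apply, le_bot_iff, iSup_eq_bot] at this
  have := this (K₀ - 1 - k)
  rw [top_apply, sub_sub_cancel, WithBot.add_eq_bot] at this
  exact this.resolve_left top_ne_bot

/-- The alternative `⊤` covers the empty meet and residuals by ε; it is not ultimately periodic,
being nonnull everywhere. -/
theorem isUltPeriodic_or_eq_top_iInf {p : ℕ} {f : Fin p → Series}
    (h : ∀ c, IsUltPeriodic (f c) ∨ f c = ⊤) : IsUltPeriodic (⨅ c, f c) ∨ ⨅ c, f c = ⊤ := by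
  rw [← Finset.inf_univ_eq_iInf]
  refine Finset.inf_induction (p := fun s => IsUltPeriodic s ∨ s = ⊤) (Or.inr rfl) ?_ fun c _ => h c
  rintro s (hs | rfl) t (ht | rfl)
  · exact Or.inl (hs.inf ht)
  · exact Or.inl (by simpa using hs)
  · exact Or.inl (by simpa using ht)
  · simp

/-! ### Slopes and errors of series within a bounded shift -/

/-- Of two series of the same period length, the smaller one does not grow faster. -/
theorem period_le_of_le {s t : Series} {K : ℤ} {ν τ₁ τ₂ : ℕ}
    (hs : ∀ k ≥ K, s (k + ν) = s k + (τ₁ : ZMax)) (ht : ∀ k ≥ K, t (k + ν) = t k + (τ₂ : ZMax))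
    (hle : t ≤ s) (ht0 : t ≠ 0) (htop : ∀ k, s k ≠ ⊤) : τ₂ ≤ τ₁ := by
  obtain ⟨k₁, hk₁⟩ := exists_apply_ne_bot ht0
  have hb : t (max k₁ K) ≠ ⊥ := fun h => hk₁ (le_bot_iff.1 (h ▸ t.mono (le_max_left k₁ K)))
  obtain ⟨M, hM⟩ := ZMax.exists_le_add_natCast (htop (max k₁ K)) hb
  -- If τ₂ exceeded τ₁, then M + 1 periods would gain at least M + 1 and overrun the initial gap M.
  have h1 := le_def.1 hle (max k₁ K + ((M + 1) * ν : ℕ))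
  rw [iterate_period hs _ _ (le_max_right _ _), iterate_period ht _ _ (le_max_right _ _)] at h1
  have h2 : t (max k₁ K) + (((M + 1) * τ₂ : ℕ) : ZMax) ≤
      t (max k₁ K) + (M : ZMax) + (((M + 1) * τ₁ : ℕ) : ZMax) := h1.trans (by gcongr)
  have hfin : t (max k₁ K) ≠ ⊤ := fun h => htop _ (top_le_iff.1 (h ▸ le_def.1 hle _))
  obtain ⟨n, hn⟩ := ((ZMax.cases _).resolve_left hb).resolve_left hfin
  rw [hn, ZMax.natCast_eq, ZMax.natCast_eq, ZMax.natCast_eq, ZMax.coe_add_coe, ZMax.coe_add_coe,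
    ZMax.coe_add_coe, ZMax.coe_le_coe] at h2
  have h3 : (M + 1) * τ₂ ≤ M + (M + 1) * τ₁ := by
    have : (((M + 1) * τ₂ : ℕ) : ℤ) ≤ M + (((M + 1) * τ₁ : ℕ) : ℤ) := by linarith
    exact_mod_cast this
  by_contra! h
  nlinarith

/-- In γ^N s ≤ t ≤ s the outer series have the same eventual increments, so `period_le_of_le`
applies in both directions. If one of `s`, `t` reaches `⊤`, so does the other, and both slopes are
0. -/
theorem exists_common_slope {s t : Series} {N : ℕ} (hs : IsUltPeriodic s) (ht : IsUltPeriodic t)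
    (hle : t ≤ s) (hN : monomial 0 N * s ≤ t) :
    (s = 0 ∧ t = 0) ∨ ∃ σ : ENNReal, HasSlope s σ ∧ HasSlope t σ := by
  have hN' : ∀ k, s k ≤ t (k + N) := fun k => by
    have := le_def.1 hN (k + N)
    rw [monomial_mul_apply, add_sub_cancel_right] at this
    exact (add_zero (s k)).ge.trans this
  by_cases h0 : s = 0
  · exact Or.inl ⟨h0, le_zero_iff.1 (hle.trans h0.le)⟩
  right
  have ht0 : t ≠ 0 := by
    rintro rfl
    exact h0 (ext fun k => le_bot_iff.1 (hN' k))
  by_cases htop : ∃ k, s k = ⊤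
  · obtain ⟨k, hk⟩ := htop
    exact ⟨0, hs.hasSlope_zero ⟨k, hk⟩, ht.hasSlope_zero ⟨k + N, top_le_iff.1 (hk ▸ hN' k)⟩⟩
  push Not at htop
  have htop' : ∀ k, t k ≠ ⊤ := fun k h => htop k (top_le_iff.1 (h ▸ le_def.1 hle k))
  obtain ⟨K, ν, τ₁, τ₂, hν, h₁, h₂⟩ := exists_common_period hs ht
  have hshift : ∀ k ≥ K + N, (monomial 0 N * s) (k + ν) = (monomial 0 N * s) k + (τ₁ : ZMax) := by
    intro k hk
    rw [monomial_mul_apply, monomial_mul_apply, show k + ν - N = k - N + ν by ring,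
      h₁ _ (by omega), add_right_comm]
  have hshift0 : monomial 0 N * s ≠ 0 := by
    obtain ⟨k, hk⟩ := exists_apply_ne_bot h0
    intro h
    refine hk ?_
    have := congrArg (fun z : Series => z (k + N)) h
    simp only [monomial_mul_apply, add_sub_cancel_right] at this
    exact (ZMax.add_coe_eq_bot_iff 0).1 this
  have hle₁ : τ₂ ≤ τ₁ := period_le_of_le h₁ h₂ hle ht0 htop
  have hle₂ : τ₁ ≤ τ₂ :=
    period_le_of_le (K := K + N) (fun k hk => h₂ k (by omega)) hshift hN hshift0 htop'
  obtain rfl := le_antisymm hle₁ hle₂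
  exact ⟨_, hs.hasSlope_div h0 htop hν h₁, ht.hasSlope_div ht0 htop' hν h₂⟩

theorem exists_bound_Ico {s t : Series} (a b : ℤ) :
    ∃ M : ℕ, ∀ q ∈ Finset.Ico a b, t q ≠ ⊥ → s q ≠ ⊤ → s q ≤ t q + (M : ZMax) := by
  have h : ∀ q, ∃ M : ℕ, t q ≠ ⊥ → s q ≠ ⊤ → s q ≤ t q + (M : ZMax) := by
    intro q
    by_cases hq : t q ≠ ⊥ ∧ s q ≠ ⊤
    · obtain ⟨M, hM⟩ := ZMax.exists_le_add_natCast hq.2 hq.1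
      exact ⟨M, fun _ _ => hM⟩
    · exact ⟨0, fun h1 h2 => absurd ⟨h1, h2⟩ hq⟩
  choose f hf using h
  refine ⟨(Finset.Ico a b).sup f, fun q hq h1 h2 => (hf q h1 h2).trans ?_⟩
  have : f q ≤ (Finset.Ico a b).sup f := Finset.le_sup hq
  gcongr

theorem exists_error_bound {s t : Series} {N : ℕ} (hs : IsUltPeriodic s) (ht : IsUltPeriodic t)
    (hN : monomial 0 N * s ≤ t) :
    ∃ M : ℕ, (∀ q : ℤ, t q ≠ ⊥ → s q ≠ ⊤ → s q ≤ t q + (M : ZMax)) ∧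
      ∀ᶠ q : ℤ in Filter.atTop, s q ≤ t q + (M : ZMax) := by
  obtain ⟨-, K, ν, τ, hν, h⟩ := hs
  obtain ⟨⟨K₀, h₀⟩, -⟩ := ht
  obtain ⟨M, hM⟩ := exists_bound_Ico (s := s) (t := t) K₀ (K + (N * ν : ℕ))
  -- Going back N periods costs Nτ and moves by Nν ≥ N, so s(q) = s(q - Nν) + Nτ ≤ s(q - N) + Nτ ≤
  -- t(q) + Nτ. Only finitely many q remain above K₀.
  have hlarge : ∀ q ≥ K + (N * ν : ℕ), s q ≤ t q + ((N * τ : ℕ) : ZMax) := by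
    intro q hq
    have h1 := iterate_period h N (q - (N * ν : ℕ)) (by omega)
    rw [sub_add_cancel] at h1
    rw [h1]
    gcongr
    have h2 := le_def.1 hN q
    rw [monomial_mul_apply] at h2
    refine (s.mono ?_).trans ((add_zero (s (q - N))).ge.trans h2)
    have : N ≤ N * ν := Nat.le_mul_of_pos_right N hν
    omega
  have hlarge' : ∀ q ≥ K + (N * ν : ℕ), s q ≤ t q + ((max M (N * τ) : ℕ) : ZMax) := by
    intro q hq
    refine (hlarge q hq).trans ?_
    gcongr
    exact le_max_right _ _
  refine ⟨max M (N * τ), fun q h1 h2 => ?_, Filter.eventually_atTop.2 ⟨_, hlarge'⟩⟩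
  rcases lt_or_ge q (K + (N * ν : ℕ)) with hq | hq
  · refine (hM q (Finset.mem_Ico.2 ⟨?_, hq⟩) h1 h2).trans ?_
    · by_contra! hlt
      exact h1 (h₀ q hlt)
    · gcongr
      exact le_max_left _ _
  · exact hlarge' q hq

end Series

/-! ### Event graphs and the observer -/

open Series

theorem IsEventGraphMatrix.mem_rational {n : ℕ} {A : Matrix (Fin n) (Fin n) Series}
    (hA : IsEventGraphMatrix A) (i j : Fin n) : A i j ∈ rational := by
  obtain ⟨places, h⟩ := hA
  rw [h]
  exact sum_mem fun b _ => monomial_mem_rational b.1 b.2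

theorem IsEventGraphMatrix.matStar_mem_periodic {n : ℕ} {A : Matrix (Fin n) (Fin n) Series}
    (hA : IsEventGraphMatrix A) (i j : Fin n) : matStar A i j ∈ periodic :=
  rational_le_periodic
    (matStar_mem rational (fun _ => star_mem_rational) (hA.mem_rational) i j)

theorem IsInputMatrix.mem_periodic {n p : ℕ} {B : Matrix (Fin n) (Fin p) Series}
    (hB : IsInputMatrix B) (i : Fin n) (c : Fin p) : B i c ∈ periodic := by
  obtain ⟨f, -, h⟩ := hB
  rw [h]
  split_ifs
  · exact one_mem _
  · exact zero_mem _

theorem mul_mem_entries {S : Subsemiring Series} {m n p : ℕ} {M : Matrix (Fin m) (Fin n) Series}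
    {N : Matrix (Fin n) (Fin p) Series} (hM : ∀ i j, M i j ∈ S) (hN : ∀ i j, N i j ∈ S)
    (i : Fin m) (j : Fin p) : (M * N) i j ∈ S := by
  rw [Matrix.mul_apply]
  exact sum_mem fun q _ => mul_mem (hM i q) (hN q j)

theorem mulVec_mem_entries {S : Subsemiring Series} {m n : ℕ} {M : Matrix (Fin m) (Fin n) Series}
    {v : Fin n → Series} (hM : ∀ i j, M i j ∈ S) (hv : ∀ j, v j ∈ S) (i : Fin m) :
    M.mulVec v i ∈ S := by
  rw [Matrix.mulVec, dotProduct]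
  exact sum_mem fun q _ => mul_mem (hM i q) (hv q)

theorem IsOutputMatrix.mulVec_apply {n m : ℕ} {C : Matrix (Fin m) (Fin n) Series}
    {o : Fin m → Fin n} (hC : IsOutputMatrix C o) (v : Fin n → Series) (r : Fin m) :
    C.mulVec v r = v (o r) := by
  simp [Matrix.mulVec, dotProduct, hC.2]

theorem IsOutputMatrix.mul_apply {n m p : ℕ} {C : Matrix (Fin m) (Fin n) Series}
    {o : Fin m → Fin n} (hC : IsOutputMatrix C o) (M : Matrix (Fin n) (Fin p) Series)
    (r : Fin m) (c : Fin p) : (C * M) r c = M (o r) c := by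
  simp [Matrix.mul_apply, hC.2]

/-- Choose one place per arc of a path: N is its total number of tokens, and the holding times,
being nonnegative, may be lowered to 0. -/
theorem Reaches.exists_monomial_le_matStar {n : ℕ} {A : Matrix (Fin n) (Fin n) Series}
    (hA : IsEventGraphMatrix A) {i j : Fin n} (h : Reaches A j i) :
    ∃ N : ℕ, monomial 0 N ≤ matStar A i j := by
  induction h with
  | refl => exact ⟨0, one_le_matStar A j⟩
  | @tail b c _ hbc ih =>
    obtain ⟨N, hN⟩ := ih
    obtain ⟨places, hpl⟩ := hA
    obtain ⟨m, hm⟩ : (places c b).Nonempty := by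
      by_contra hne
      rw [Finset.not_nonempty_iff_eq_empty] at hne
      exact hbc (by rw [hpl, hne, Finset.sum_empty])
    refine ⟨m.2 + N, le_trans ?_ (mul_matStar_le A c b j)⟩
    have h1 : monomial 0 (m.2 : ℤ) ≤ A c b := by
      rw [hpl]
      refine le_trans ?_ (le_sum (fun b : ℕ × ℕ => monomial (b.1 : ℤ) (b.2 : ℤ)) hm)
      rw [monomial_le_iff, monomial_apply, if_pos le_rfl, ZMax.coe_le_coe]
      positivity
    have := mul_le_mul_of_le h1 hN
    rwa [monomial_mul_monomial, add_zero, ← Nat.cast_add] at this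

theorem le_matResidual_iff {n m p : ℕ} {N : Matrix (Fin n) (Fin p) Series}
    {M : Matrix (Fin m) (Fin p) Series} {i : Fin n} {j : Fin m} {X : Series} :
    X ≤ matResidual N M i j ↔ ∀ c, X * M j c ≤ N i c := by
  simp only [matResidual, Matrix.of_apply, le_iInf_iff, leftMulResiduation_le_iff_mul_le]

theorem isUltPeriodic_or_eq_top_matResidual {n m p : ℕ} {N : Matrix (Fin n) (Fin p) Series}
    {M : Matrix (Fin m) (Fin p) Series} (hN : ∀ i c, IsUltPeriodic (N i c))
    (hM : ∀ j c, IsUltPeriodic (M j c)) (i : Fin n) (j : Fin m) :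
    IsUltPeriodic (matResidual N M i j) ∨ matResidual N M i j = ⊤ := by
  refine isUltPeriodic_or_eq_top_iInf fun c => ?_
  by_cases h : M j c = 0
  · rw [h]
    exact Or.inr (residual_zero _)
  · exact Or.inl ((hN i c).residual (hM j c) h)

section Observer

variable {n p l m : ℕ} {A : Matrix (Fin n) (Fin n) Series} {B : Matrix (Fin n) (Fin p) Series}
  {C : Matrix (Fin m) (Fin n) Series} {R : Matrix (Fin n) (Fin l) Series} {o : Fin m → Fin n}
  {u : Fin p → Series} {w : Fin l → Series}

theorem le_observerMatrix_iff {i : Fin n} {r : Fin m} {X : Series} :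
    X ≤ observerMatrix A B C R i r ↔
      (∀ c, X * (C * matStar A * B) r c ≤ (matStar A * B) i c) ∧
        ∀ c, X * (C * matStar A * R) r c ≤ (matStar A * R) i c := by
  rw [observerMatrix, Matrix.of_apply, le_inf_iff, le_matResidual_iff, le_matResidual_iff]

theorem state_eq : state A B R u w = (matStar A * B).mulVec u + (matStar A * R).mulVec w := by
  rw [state, Matrix.mulVec_add, Matrix.mulVec_mulVec, Matrix.mulVec_mulVec]

theorem mulVec_state_eq :
    C.mulVec (state A B R u w) =
      (C * matStar A * B).mulVec u + (C * matStar A * R).mulVec w := by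
  rw [state_eq, Matrix.mulVec_add, Matrix.mulVec_mulVec, Matrix.mulVec_mulVec, Matrix.mul_assoc,
    Matrix.mul_assoc]

/-- With x = A*Bu ⊕ A*Rw, the two residuals defining L bound the contributions of u and w
separately. -/
theorem observerMatrix_mul_mulVec_state_le (i : Fin n) (r : Fin m) :
    observerMatrix A B C R i r * C.mulVec (state A B R u w) r ≤ state A B R u w i := by
  obtain ⟨hB, hR⟩ := (le_observerMatrix_iff (A := A) (B := B) (C := C) (R := R) (i := i)
    (r := r)).1 le_rfl
  rw [mulVec_state_eq, state_eq]
  simp only [Pi.add_apply, mul_add, Matrix.mulVec, dotProduct, Finset.mul_sum, ← mul_assoc]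
  exact add_le_add (Finset.sum_le_sum fun c _ => mul_le_mul_of_le (hB c) le_rfl)
    (Finset.sum_le_sum fun c _ => mul_le_mul_of_le (hR c) le_rfl)

theorem observerMatrix_mulVec_le :
    (observerMatrix A B C R).mulVec (C.mulVec (state A B R u w)) ≤ state A B R u w :=
  fun i => sum_le fun r _ => observerMatrix_mul_mulVec_state_le i r

theorem mulVec_state_add_le :
    A.mulVec (state A B R u w) + (B.mulVec u + R.mulVec w) ≤ state A B R u w :=
  mulVec_matStar_mulVec_le A _

/-- The state satisfies the inequality of which the estimate is the least solution. -/
theorem estimate_le_state : estimate A B C R u w ≤ state A B R u w := by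
  refine matStar_mulVec_le fun i => ?_
  rw [Matrix.add_mulVec, ← Matrix.mulVec_mulVec]
  have h1 := add_le_iff.1 (mulVec_state_add_le (A := A) (B := B) (R := R) (u := u) (w := w) i)
  have h2 := observerMatrix_mulVec_le (A := A) (B := B) (C := C) (R := R) (u := u) (w := w) i
  exact add_le_iff.2 ⟨add_le_iff.2 ⟨h1.1, h2⟩, add_le_iff.2 ⟨(add_le_iff.1 h1.2).1, h2⟩⟩

/-- The estimate is `A*(B u ⊕ L C x)`: the feedback of its own output is dominated by that of the
output of the system. -/
theorem estimate_eq :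
    estimate A B C R u w = (matStar A).mulVec
      (B.mulVec u + (observerMatrix A B C R).mulVec (C.mulVec (state A B R u w))) := by
  have he := mulVec_matStar_mulVec_le (A + observerMatrix A B C R * C)
    (B.mulVec u + (observerMatrix A B C R).mulVec (C.mulVec (state A B R u w)))
  have hz := mulVec_matStar_mulVec_le A
    (B.mulVec u + (observerMatrix A B C R).mulVec (C.mulVec (state A B R u w)))
  have hle : (matStar A).mulVec
      (B.mulVec u + (observerMatrix A B C R).mulVec (C.mulVec (state A B R u w))) ≤
        estimate A B C R u w := by
    refine matStar_mulVec_le fun i => ?_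
    have := add_le_iff.1 (he i)
    rw [Matrix.add_mulVec] at this
    exact add_le_iff.2 ⟨(add_le_iff.1 this.1).1, this.2⟩
  refine le_antisymm (matStar_mulVec_le fun i => ?_) hle
  have h1 := add_le_iff.1 (hz i)
  refine add_le_iff.2 ⟨?_, h1.2⟩
  rw [Matrix.add_mulVec, ← Matrix.mulVec_mulVec]
  -- For z = A*(Bu ⊕ LCx), z ≤ x̂ ≤ x gives LCz ≤ LCx, which is already part of the source.
  refine add_le_iff.2 ⟨h1.1, le_trans ?_ (add_le_iff.1 h1.2).2⟩
  exact mulVec_mono _ (mulVec_mono _ (hle.trans estimate_le_state)) i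

theorem isUltPeriodic_state (hA : IsEventGraphMatrix A) (hB : IsInputMatrix B)
    (hR : IsInputMatrix R) (hu : ∀ c, (u c).IsPeriodic) (hw : ∀ c, (w c).IsPeriodic) (i : Fin n) :
    IsUltPeriodic (state A B R u w i) :=
  mulVec_mem_entries (S := periodic) hA.matStar_mem_periodic
    (fun j => add_mem (mulVec_mem_entries hB.mem_periodic (fun c => (hu c).isUltPeriodic) j)
      (mulVec_mem_entries hR.mem_periodic (fun c => (hw c).isUltPeriodic) j)) i

theorem isUltPeriodic_observerMatrix_mul (hA : IsEventGraphMatrix A) (hB : IsInputMatrix B)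
    (hR : IsInputMatrix R) (hC : IsOutputMatrix C o) (hu : ∀ c, (u c).IsPeriodic)
    (hw : ∀ c, (w c).IsPeriodic) (i : Fin n) (r : Fin m) :
    IsUltPeriodic (observerMatrix A B C R i r * C.mulVec (state A B R u w) r) := by
  have hP : ∀ i c, IsUltPeriodic ((matStar A * B) i c) :=
    mul_mem_entries (S := periodic) hA.matStar_mem_periodic hB.mem_periodic
  have hQ : ∀ i c, IsUltPeriodic ((matStar A * R) i c) :=
    mul_mem_entries (S := periodic) hA.matStar_mem_periodic hR.mem_periodic
  have hCP : ∀ r c, IsUltPeriodic ((C * matStar A * B) r c) := fun r c => by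
    rw [Matrix.mul_assoc, hC.mul_apply]
    exact hP _ _
  have hCQ : ∀ r c, IsUltPeriodic ((C * matStar A * R) r c) := fun r c => by
    rw [Matrix.mul_assoc, hC.mul_apply]
    exact hQ _ _
  have hx : IsUltPeriodic (C.mulVec (state A B R u w) r) := by
    rw [hC.mulVec_apply]
    exact isUltPeriodic_state hA hB hR hu hw _
  have hL : IsUltPeriodic (observerMatrix A B C R i r) ∨ observerMatrix A B C R i r = ⊤ := by
    rw [observerMatrix, Matrix.of_apply]
    rcases isUltPeriodic_or_eq_top_matResidual hP hCP i r with h1 | h1 <;>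
      rcases isUltPeriodic_or_eq_top_matResidual hQ hCQ i r with h2 | h2
    · exact Or.inl (h1.inf h2)
    · exact Or.inl (by rwa [h2, inf_top_eq])
    · exact Or.inl (by rwa [h1, top_inf_eq])
    · exact Or.inr (by rw [h1, h2, top_inf_eq])
  rcases hL with hL | hL
  · exact hL.mul hx
  -- An entry `⊤` forces row r of CA*B and of CA*R to vanish, hence output r is null and so is the
  -- product.
  · obtain ⟨h1, h2⟩ := le_observerMatrix_iff.1 hL.ge
    have : C.mulVec (state A B R u w) r = 0 := by
      rw [mulVec_state_eq]
      simp [Matrix.mulVec, dotProduct, fun c => eq_zero_of_top_mul_le (hP i c) (h1 c),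
        fun c => eq_zero_of_top_mul_le (hQ i c) (h2 c)]
    rw [this, mul_zero]
    exact isUltPeriodic_zero

/-- The form `estimate_eq` needs only the star of A. Entries of L may be `⊤`, so the rational
argument does not directly apply to the star of A ⊕ LC. -/
theorem isUltPeriodic_estimate (hA : IsEventGraphMatrix A) (hB : IsInputMatrix B)
    (hR : IsInputMatrix R) (hC : IsOutputMatrix C o) (hu : ∀ c, (u c).IsPeriodic)
    (hw : ∀ c, (w c).IsPeriodic) (i : Fin n) : IsUltPeriodic (estimate A B C R u w i) := by
  rw [estimate_eq]
  refine mulVec_mem_entries (S := periodic) hA.matStar_mem_periodic (fun j => add_mem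
    (mulVec_mem_entries hB.mem_periodic (fun c => (hu c).isUltPeriodic) j) ?_) i
  exact isUltPeriodic_sum fun r _ => isUltPeriodic_observerMatrix_mul hA hB hR hC hu hw j r

/-- Row r of CA* is row `o r` of A*, so A*A* ≤ A* makes column `o r` of A* admissible in both
residuals. -/
theorem matStar_le_observerMatrix (hC : IsOutputMatrix C o) (i : Fin n) (r : Fin m) :
    matStar A i (o r) ≤ observerMatrix A B C R i r := by
  have key : ∀ {q : ℕ} (D : Matrix (Fin n) (Fin q) Series) (c : Fin q),
      matStar A i (o r) * (C * matStar A * D) r c ≤ (matStar A * D) i c := by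
    intro q D c
    rw [Matrix.mul_assoc, hC.mul_apply, Matrix.mul_apply, Matrix.mul_apply, Finset.mul_sum]
    refine Finset.sum_le_sum fun j _ => ?_
    rw [← mul_assoc]
    exact mul_le_mul_of_le (matStar_mul_matStar_le A i (o r) j) le_rfl
  exact le_observerMatrix_iff.2 ⟨key B, key R⟩

theorem matStar_mul_state_le (i j : Fin n) :
    matStar A i j * state A B R u w j ≤ state A B R u w i := by
  rw [state]
  simp only [Matrix.mulVec, dotProduct, Finset.mul_sum, ← mul_assoc]
  exact Finset.sum_le_sum fun q _ =>
    mul_le_mul_of_le (matStar_mul_matStar_le A i j q) le_rfl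

/-- In a strongly connected component with an output, the estimate follows the state with a bounded
shift of the numbering of the events. -/
theorem exists_monomial_mul_state_le_estimate (hA : IsEventGraphMatrix A)
    (hC : IsOutputMatrix C o) {i : Fin n} {r : Fin m} (h : SCC.mk A (o r) = SCC.mk A i) :
    ∃ N : ℕ, monomial 0 N * state A B R u w i ≤ estimate A B C R u w i := by
  obtain ⟨h1, h2⟩ : Reaches A (o r) i ∧ Reaches A i (o r) := Quotient.exact h
  obtain ⟨N₁, hN₁⟩ := h1.exists_monomial_le_matStar hA
  obtain ⟨N₂, hN₂⟩ := h2.exists_monomial_le_matStar hA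
  refine ⟨N₁ + N₂, ?_⟩
  have hL := hN₁.trans (matStar_le_observerMatrix (A := A) (B := B) (R := R) hC i r)
  have hx := (mul_le_mul_of_le hN₂ le_rfl).trans
    (matStar_mul_state_le (A := A) (B := B) (R := R) (u := u) (w := w) (o r) i)
  -- Token counts add along the cycle: γ^N₂ carries xᵢ to the output, and γ^N₁ ≤ L(i, r) carries it
  -- back to i.
  have hLx := mul_le_mul_of_le hL hx
  rw [← mul_assoc, monomial_mul_monomial, add_zero, ← Nat.cast_add,
    ← hC.mulVec_apply (state A B R u w) r] at hLx
  refine hLx.trans ?_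
  rw [estimate_eq]
  refine le_trans ?_ (add_le_iff.1 (mulVec_matStar_mulVec_le A _ i)).2
  refine le_trans ?_ (le_add_right' _ _)
  exact le_sum (fun r => observerMatrix A B C R i r * C.mulVec (state A B R u w) r)
    (Finset.mem_univ r)

end Observer

end MaxPlus

theorem proposition3 (n p l k : ℕ)
    (A : Matrix (Fin n) (Fin n) MaxPlus.Series) (B : Matrix (Fin n) (Fin p) MaxPlus.Series)
    (C : Matrix (Fin k) (Fin n) MaxPlus.Series) (R : Matrix (Fin n) (Fin l) MaxPlus.Series)
    (o : Fin k → Fin n)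
    (hA : MaxPlus.IsEventGraphMatrix A) (hB : MaxPlus.IsInputMatrix B)
    (hR : MaxPlus.IsInputMatrix R) (hC : MaxPlus.IsOutputMatrix C o)
    (hk : k = Nat.card (MaxPlus.SCC A))
    (hlink : ∀ K : MaxPlus.SCC A, ∃! r : Fin k, MaxPlus.SCC.mk A (o r) = K)
    (u : Fin p → MaxPlus.Series) (w : Fin l → MaxPlus.Series)
    (hu : ∀ c, (u c).IsPeriodic) (hw : ∀ c, (w c).IsPeriodic) (i : Fin n) :
    -- the state and its estimate have the same asymptotic slope (unless both are null)
    ((MaxPlus.state A B R u w i = 0 ∧ MaxPlus.estimate A B C R u w i = 0) ∨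
      ∃ σ : ENNReal, (MaxPlus.state A B R u w i).HasSlope σ ∧
        (MaxPlus.estimate A B C R u w i).HasSlope σ) ∧
    -- the estimation error is bounded
    (∀ q : ℤ, MaxPlus.estimate A B C R u w i q ≤ MaxPlus.state A B R u w i q) ∧
    ∃ M : ℕ,
      (∀ q : ℤ, MaxPlus.estimate A B C R u w i q ≠ ⊥ → MaxPlus.state A B R u w i q ≠ ⊤ →
        MaxPlus.state A B R u w i q ≤ MaxPlus.estimate A B C R u w i q + (M : MaxPlus.ZMax)) ∧
      ∀ᶠ q : ℤ in Filter.atTop,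
        MaxPlus.state A B R u w i q ≤ MaxPlus.estimate A B C R u w i q + (M : MaxPlus.ZMax) := by
  obtain ⟨r, hr, -⟩ := hlink (MaxPlus.SCC.mk A i)
  obtain ⟨N, hN⟩ := MaxPlus.exists_monomial_mul_state_le_estimate (B := B) (R := R) (u := u)
    (w := w) hA hC hr
  have hs := MaxPlus.isUltPeriodic_state hA hB hR hu hw i
  have ht := MaxPlus.isUltPeriodic_estimate hA hB hR hC hu hw i
  have hle : MaxPlus.estimate A B C R u w i ≤ MaxPlus.state A B R u w i :=
    MaxPlus.estimate_le_state i
  exact ⟨MaxPlus.Series.exists_common_slope hs ht hle hN, MaxPlus.Series.le_def.1 hle,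
    MaxPlus.Series.exists_error_bound hs ht hN⟩
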